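/- Let $\tau=(1+\sqrt5)/2$ and $\theta=(3\tau+1)/2$. **Fibonacci chain.** Let $\varrho$ be the substitution $a\mapsto ab$, $b\mapsto a$, and let $u=u_0u_1u_2\cdots=abaab\cdots$ be the one-sided Fibonacci word, i.e. the limit of the words $\varrho^n(a)$. Let $w=(w_i)_{i\in\mathbb Z}=\cdots u_2u_1u_0\,ba\,|\,u_0u_1u_2\cdots$, the bar standing between positions $-1$ and $0$. Put $|a|=\tau$, $|b|=1$, and let $S=\{S_i: i\in\mathbb Z\}\subset\mathbb R$ be given by $S_0=0$ and $S_i=S_{i-1}+|w_{i-1}|$ for all $i\in\mathbb Z$. **Potential.** For $x\ge 0$ let $\alpha(x)=\sup\{y\in S: y\le x\}$ and $\beta(x)=\inf\{y\in S: y>x\}$. For $-\tau^2\le x<0$ let $\alpha(x)=-\beta(-x)$, $\beta(x)=-\alpha(-x)$, and for $x<-\tau^2$ let $\alpha(x)=-\beta(-x-\tau^2)-\tau^2$, $\beta(x)=-\alpha(-x-\tau^2)-\tau^2$. Let $c(x)=\alpha(x)$ if $2x\le\alpha(x)+\beta(x)$ and $c(x)=\beta(x)$ otherwise (the point of $S$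 closest to $x$). Let $$\zeta(x)=\begin{cases}-64x^2+\frac{160}{27}, & |x|\le\frac14,\\ \frac{64}{27}(3|x|-1)^2(96|x|-11), & \frac14<|x|<\frac13,\\ 0,&\text{otherwise,}\end{cases}$$ and let $V(x)=\zeta(x-c(x))$ for $x\in\mathbb R$. **Configurations.** Let $H(\xi,\eta)=\frac12(\xi-\eta)^2+V(\xi)$. A configuration $x\in\mathbb R^{\mathbb Z}$ is *minimal* if for all integers $j<k$ and all real $y_j,\dots,y_k$ with $y_j=x_j$, $y_k=x_k$ one has $\sum_{i=j}^{k-1}H(x_i,x_{i+1})\le\sum_{i=j}^{k-1}H(y_i,y_{i+1})$. It is an *equilibrium* if $\partial_2H(x_{i-1},x_i)+\partial_1H(x_i,x_{i+1})=0$ for all $i\in\mathbb Z$, i.e. $2x_i-x_{i-1}-x_{i+1}+V'(x_i)=0$. It has *rotation number* $r$ if $x_i/i\to r$ both as $i\to+\infty$ and as $i\to-\infty$. **Theorem.** (i) There is a minimal configuration with rotation number $\theta$. (ii) There is an equilibrium configuration $x$ with rotation number $\theta$ that is not minimal; moreover it can be chosen so that $|x_i-c(\theta i)|\le\tau/62$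 for all $i\in\mathbb Z$. -/

import Mathlib

namespace FibFK

open Filter Topology

/-- The two-letter alphabet. -/
inductive Letter
  | a
  | b

/-- The substitution rule on letters: `a ↦ ab`, `b ↦ a`. -/
def substLetter : Letter → List Letter
  | .a => [.a, .b]
  | .b => [.a]

/-- The substitution rule, extended to finite words by concatenation. -/
def subst (v : List Letter) : List Letter := v.flatMap substLetter

/-- `fibWord n` is the image of the word `a` under `n` substitutions:
`a, ab, aba, abaab, …`. -/
def fibWord (n : ℕ) : List Letter := subst^[n] [.a]

/-- The one-sided Fibonacci word, the limit of the words `fibWord n`. The letter at position `k`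
can be read off from `fibWord k`, see `lt_length_fibWord` and `fibWord_getElem?`. -/
def oneSided (k : ℕ) : Letter := (fibWord k).getD k .a

/-- The two-sided Fibonacci word `⋯ u₂ u₁ u₀ b a | u₀ u₁ u₂ ⋯`, where `u` is the one-sided
Fibonacci word and the bar stands between the positions `-1` and `0`. -/
def twoSided : ℤ → Letter
  | Int.ofNat k => oneSided k
  | Int.negSucc 0 => .a
  | Int.negSucc 1 => .b
  | Int.negSucc (k + 2) => oneSided k

/-- The lengths `|a| = τ` and `|b| = 1`, where `τ` is the golden ratio. -/
noncomputable def len : Letter → ℝ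
  | .a => Real.goldenRatio
  | .b => 1

/-- The Fibonacci chain as a sequence: the solution of `S 0 = 0`, `S i = S (i - 1) + |w (i - 1)|`
with `w` the two-sided Fibonacci word, see `chain_zero` and `chain_rec`. -/
noncomputable def chain : ℤ → ℝ
  | Int.ofNat n => ∑ k ∈ Finset.range n, len (twoSided k)
  | Int.negSucc n => -∑ k ∈ Finset.range (n + 1), len (twoSided (Int.negSucc k))

/-- The Fibonacci chain as a point set. -/
def chainSet : Set ℝ := Set.range chain

/-- The largest chain point `≤ x`, used for `x ≥ 0`. -/
noncomputable def alphaPos (x : ℝ) : ℝ := sSup {y | y ∈ chainSet ∧ y ≤ x}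

/-- The smallest chain point `> x`, used for `x ≥ 0`. -/
noncomputable def betaPos (x : ℝ) : ℝ := sInf {y | y ∈ chainSet ∧ x < y}

/-- The left neighbour of `x` in the chain, extended to negative `x` by reflection. -/
noncomputable def alpha (x : ℝ) : ℝ :=
  if 0 ≤ x then alphaPos x
  else if -Real.goldenRatio ^ 2 ≤ x then -betaPos (-x)
  else -betaPos (-x - Real.goldenRatio ^ 2) - Real.goldenRatio ^ 2

/-- The right neighbour of `x` in the chain, extended to negative `x` by reflection. -/
noncomputable def beta (x : ℝ) : ℝ :=
  if 0 ≤ x then betaPos x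
  else if -Real.goldenRatio ^ 2 ≤ x then -alphaPos (-x)
  else -alphaPos (-x - Real.goldenRatio ^ 2) - Real.goldenRatio ^ 2

/-- The chain point closest to `x` (the left one in case of a tie). -/
noncomputable def nearest (x : ℝ) : ℝ :=
  if 2 * x ≤ alpha x + beta x then alpha x else beta x

/-- The bump function. -/
noncomputable def zeta (x : ℝ) : ℝ :=
  if |x| ≤ 1 / 4 then -64 * x ^ 2 + 160 / 27
  else if |x| < 1 / 3 then 64 / 27 * (3 * |x| - 1) ^ 2 * (96 * |x| - 11)
  else 0

/-- The potential driven by the Fibonacci chain. -/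
noncomputable def V (x : ℝ) : ℝ := zeta (x - nearest x)

/-- The generating function of the Frenkel-Kontorova model with potential `W`. -/
noncomputable def fkH (W : ℝ → ℝ) (ξ η : ℝ) : ℝ := 1 / 2 * (ξ - η) ^ 2 + W ξ

/-- The energy of the segment `(x_j, …, x_k)`. -/
noncomputable def segmentEnergy (H : ℝ → ℝ → ℝ) (x : ℤ → ℝ) (j k : ℤ) : ℝ :=
  ∑ i ∈ Finset.Ico j k, H (x i) (x (i + 1))

/-- A configuration is minimal if each of its finite segments has the least energy among the
segments with the same end points. (Only the entries of `y` from `j` to `k` matter.) -/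
def IsMinimalConfig (H : ℝ → ℝ → ℝ) (x : ℤ → ℝ) : Prop :=
  ∀ j k : ℤ, j < k → ∀ y : ℤ → ℝ, y j = x j → y k = x k →
    segmentEnergy H x j k ≤ segmentEnergy H y j k

/-- A configuration is an equilibrium if `∂₂H(x_{i-1}, x_i) + ∂₁H(x_i, x_{i+1}) = 0` for all `i`;
the existence of these partial derivatives is part of the requirement. -/
def IsEquilibrium (H : ℝ → ℝ → ℝ) (x : ℤ → ℝ) : Prop :=
  ∀ i : ℤ, ∃ p q : ℝ,
    HasDerivAt (fun η => H (x (i - 1)) η) p (x i) ∧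
    HasDerivAt (fun ξ => H ξ (x (i + 1))) q (x i) ∧ p + q = 0

/-- `x i / i → r` both as `i → +∞` and as `i → -∞`. -/
def HasRotationNumber (x : ℤ → ℝ) (r : ℝ) : Prop :=
  Tendsto (fun i : ℤ => x i / (i : ℝ)) atTop (𝓝 r) ∧
  Tendsto (fun i : ℤ => x i / (i : ℝ)) atBot (𝓝 r)

theorem fibWord_succ (n : ℕ) : fibWord (n + 1) = subst (fibWord n) :=
  Function.iterate_succ_apply' _ _ _

theorem fibWord_add_two (n : ℕ) : fibWord (n + 2) = fibWord (n + 1) ++ fibWord n := by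
  induction n with
  | zero => rfl
  | succ n ih =>
    have h : fibWord (n + 3) = subst (fibWord (n + 1)) ++ subst (fibWord n) := by
      rw [fibWord_succ (n + 2), ih, subst, List.flatMap_append, subst, subst]
    rw [← fibWord_succ, ← fibWord_succ] at h
    exact h

theorem lt_length_fibWord (n : ℕ) : n < (fibWord n).length := by
  induction n using Nat.strong_induction_on with
  | _ n ih =>
    match n, ih with
    | 0, _ => decide
    | 1, _ => decide
    | n + 2, ih =>
      have h1 := ih (n + 1) (by omega)
      have h2 := ih n (by omega)
      rw [fibWord_add_two, List.length_append]
      omega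

theorem fibWord_prefix_succ (n : ℕ) : fibWord n <+: fibWord (n + 1) := by
  cases n with
  | zero => exact ⟨[.b], rfl⟩
  | succ n => exact ⟨fibWord n, (fibWord_add_two n).symm⟩

theorem fibWord_prefix {m n : ℕ} (h : m ≤ n) : fibWord m <+: fibWord n := by
  induction h with
  | refl => exact List.prefix_rfl
  | step _ ih => exact ih.trans (fibWord_prefix_succ _)

/-- All sufficiently long words `fibWord n` carry the letter `oneSided k` at position `k`. -/
theorem fibWord_getElem? {k n : ℕ} (h : k ≤ n) : (fibWord n)[k]? = some (oneSided k) := by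
  have hk := lt_length_fibWord k
  rw [List.prefix_iff_getElem?.1 (fibWord_prefix h) k hk, oneSided,
    List.getD_eq_getElem _ _ hk]

theorem chain_zero : chain 0 = 0 := by
  change ∑ k ∈ Finset.range 0, len (twoSided k) = 0
  simp

theorem chain_rec (i : ℤ) : chain i = chain (i - 1) + len (twoSided (i - 1)) := by
  match i with
  | Int.ofNat 0 =>
    change ∑ k ∈ Finset.range 0, len (twoSided k) =
      -∑ k ∈ Finset.range (0 + 1), len (twoSided (Int.negSucc k)) + len (twoSided (Int.negSucc 0))
    simp
  | Int.ofNat (n + 1) =>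
    have h : Int.ofNat (n + 1) - 1 = Int.ofNat n := by simp
    rw [h]
    exact Finset.sum_range_succ _ _
  | Int.negSucc n =>
    have h : Int.negSucc n - 1 = Int.negSucc (n + 1) := rfl
    rw [h]
    change -∑ k ∈ Finset.range (n + 1), len (twoSided (Int.negSucc k)) =
      -∑ k ∈ Finset.range (n + 1 + 1), len (twoSided (Int.negSucc k)) + _
    rw [Finset.sum_range_succ _ (n + 1)]
    ring

end FibFK

namespace FibFK

open Filter Topology

/-! The potential is quasiperiodic, so rotation numbers of minimizers cannot be read off from
periodic approximation. For (i), one minimizes over long finite segments whose end points are zeros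
of `V` lying roughly `rot * n` apart (`exists_isRotSeg`). A limit of such segments is minimal; the
difficulty is to show that their points are spread evenly, uniformly in `n`, so that the limit keeps
the slope.

Evenness rests on a crossing argument in the style of Aubry (`IsRotSeg.balance_index`). Suppose that
two disjoint stretches of the line carry the same potential up to translation, but one contains at
least ten more points than the other. Then, with two different index shifts, the translate of one
stretch crosses the other; exchanging the arcs between the crossings keeps the number of points and
does not raise the energy, and equality is excluded by the equilibrium equation. So translated
copies carry the same number of points up to 9.

The chain has many such copies. By `chain_eq` it is coded by the ceilings of `(k + 1) * τ`. If `s *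
τ` is close to an integer, translation by `s` tiles preserves this coding except where `(t + 1) * τ`
is itself close to an integer, and such `t` are far apart because `τ` is badly approximable. These
almost periods `s` are relatively dense, so any two long windows of tiles hold nearly the same
number of points (`exists_window_length`). Hence the counting function is nearly linear, its slope
is fixed by the whole segment, and `exists_uniform_bound` follows. Centring the segments and passing
to a limit gives `exists_minimal_config`. Of `rot`, only the bounds 2.927 and 2.928 enter.

For (ii), put every point near the top of a bump, at `c i + y i` with `c i` the chain point nearest
to `rot * i`. There `V` is quadratic, so the equilibrium equations are linear in `y` and diagonally
dominant, hence have a small bounded solution. The energy is strictly concave in each single point,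
so the equilibrium is not minimal. -/

/-! ### A closed form of the Fibonacci chain -/

/-- The number of letters `a` in a word. -/
def numA : List Letter → ℕ
  | [] => 0
  | .a :: v => numA v + 1
  | .b :: v => numA v

theorem numA_append (v v' : List Letter) : numA (v ++ v') = numA v + numA v' := by
  induction v with
  | nil => simp [numA]
  | cons l v ih => cases l <;> simp [numA, ih]; omega

theorem subst_append (v v' : List Letter) : subst (v ++ v') = subst v ++ subst v' := by
  simp [subst]

theorem length_subst (v : List Letter) : (subst v).length = v.length + numA v := by
  induction v with
  | nil => rfl
  | cons l v ih =>
    have h : subst (l :: v) = substLetter l ++ subst v := rfl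
    rw [h, List.length_append, ih]
    cases l <;> simp [numA, substLetter] <;> omega

theorem numA_subst (v : List Letter) : numA (subst v) = v.length := by
  induction v with
  | nil => rfl
  | cons l v ih =>
    have h : subst (l :: v) = substLetter l ++ subst v := rfl
    rw [h, numA_append, ih]
    cases l <;> simp [numA, substLetter] <;> omega

/-- The prefix of length `k` of the one-sided Fibonacci word. -/
def fibPrefix (k : ℕ) : List Letter := (fibWord k).take k

theorem length_fibPrefix (k : ℕ) : (fibPrefix k).length = k := by
  have := lt_length_fibWord k
  simp [fibPrefix]; omega

theorem take_fibWord {k n : ℕ} (h : k ≤ n) : (fibWord n).take k = fibPrefix k := by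
  obtain ⟨t, ht⟩ := fibWord_prefix h
  have := lt_length_fibWord k
  rw [← ht, List.take_append_of_le_length this.le, fibPrefix]

theorem eq_fibPrefix {v : List Letter} {n : ℕ} (h : v <+: fibWord n) :
    v = fibPrefix v.length := by
  have h1 := h.trans (fibWord_prefix (le_max_left n v.length))
  rw [← take_fibWord (le_max_right n v.length)]
  exact List.prefix_iff_eq_take.1 h1

theorem fibPrefix_prefix {k n : ℕ} (h : k ≤ n) : fibPrefix k <+: fibWord n := by
  rw [← take_fibWord h]; exact List.take_prefix _ _

theorem fibPrefix_succ (k : ℕ) : fibPrefix (k + 1) = fibPrefix k ++ [oneSided k] := by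
  rw [← take_fibWord (le_refl (k + 1)), List.take_add_one, take_fibWord (Nat.le_succ k),
    fibWord_getElem? (Nat.le_succ k)]
  rfl

/-- The infinite word is fixed by the substitution, so images of prefixes are prefixes;
`length_subst` then identifies which one. -/
theorem subst_fibPrefix (k : ℕ) :
    subst (fibPrefix k) = fibPrefix (k + numA (fibPrefix k)) := by
  have h : subst (fibPrefix k) <+: fibWord (k + 1) := by
    obtain ⟨t, ht⟩ := fibPrefix_prefix (le_refl k)
    rw [fibWord_succ, ← ht, subst_append]
    exact List.prefix_append _ _
  have h2 := eq_fibPrefix h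
  rwa [length_subst, length_fibPrefix] at h2

/-- The number of letters `a` among the first `k` letters of the one-sided Fibonacci word. -/
def countA (k : ℕ) : ℕ := numA (fibPrefix k)

theorem countA_zero : countA 0 = 0 := rfl

theorem countA_succ (k : ℕ) :
    countA (k + 1) = countA k + (match oneSided k with | .a => 1 | .b => 0) := by
  rw [countA, fibPrefix_succ, numA_append, ← countA]
  cases oneSided k <;> rfl

theorem countA_add_countA (j : ℕ) : countA (j + countA j) = j := by
  rw [countA, countA, ← subst_fibPrefix, numA_subst, length_fibPrefix]

theorem countA_add_countA_succ (j : ℕ) : countA (j + countA j + 1) = j + 1 := by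
  obtain ⟨t, ht⟩ : ∃ t, substLetter (oneSided j) = .a :: t := by
    cases oneSided j
    · exact ⟨[.b], rfl⟩
    · exact ⟨[], rfl⟩
  have h1 : fibPrefix (j + 1 + countA (j + 1)) = (fibPrefix (j + countA j) ++ [.a]) ++ t := by
    rw [countA, countA, ← subst_fibPrefix, fibPrefix_succ, subst_append, subst_fibPrefix]
    simp [subst, ht]
  have h2 : fibPrefix (j + countA j) ++ [.a] <+: fibWord (j + 1 + countA (j + 1)) :=
    List.IsPrefix.trans ⟨t, h1.symm⟩ (fibPrefix_prefix le_rfl)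
  have h3 := eq_fibPrefix h2
  rw [List.length_append, length_fibPrefix] at h3
  rw [countA, show j + countA j + 1 = j + countA j + [Letter.a].length from rfl, ← h3,
    numA_append, ← countA, countA_add_countA]
  rfl

/-- Desubstitution: the numbers `j + countA j` are the lengths of the images of prefixes, and they
grow in steps of 1 or 2. -/
theorem exists_eq_add_countA (k : ℕ) : ∃ j, k = j + countA j ∨ k = j + countA j + 1 := by
  induction k with
  | zero => exact ⟨0, Or.inl rfl⟩
  | succ k ih =>
    obtain ⟨j, h | h⟩ := ih
    · exact ⟨j, Or.inr (by omega)⟩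
    · have h1 := countA_succ j
      refine ⟨j + 1, ?_⟩
      cases hj : oneSided j <;> simp only [hj] at h1 <;> omega

theorem goldenRatio_gt : (1.618 : ℝ) < Real.goldenRatio := by
  have h1 := Real.goldenRatio_sq
  have h2 := Real.goldenRatio_pos
  nlinarith

theorem goldenRatio_lt : Real.goldenRatio < 1.6181 := by
  have h1 := Real.goldenRatio_sq
  have h2 := Real.goldenRatio_pos
  nlinarith

/-- Let `e k = countA k + k + 1 - (k + 1) * τ`. Desubstituting `k` to `j` turns `e j` into `-1 - (τ
- 1) * e j` or `-(τ - 1) * (e j + 1)`, and both maps send the interval `(-1, 0)` into itself. -/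
theorem countA_bounds (k : ℕ) :
    ((k : ℝ) + 1) * Real.goldenRatio - 1 < countA k + k + 1 ∧
      (countA k + k + 1 : ℝ) < (k + 1) * Real.goldenRatio := by
  have hτ := Real.goldenRatio_sq
  have hτ1 := goldenRatio_gt
  have hτ2 := goldenRatio_lt
  set τ := Real.goldenRatio
  induction k using Nat.strong_induction_on with
  | _ k ih =>
    rcases Nat.eq_zero_or_pos k with rfl | hk
    · simp only [countA_zero]; push_cast; constructor <;> linarith
    · obtain ⟨j, hj⟩ := exists_eq_add_countA k
      have h1 : countA 1 = 1 := rfl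
      have hpos : ∀ m : ℕ, 1 ≤ countA (m + 1) := by
        intro m
        induction m with
        | zero => exact h1.ge
        | succ m ihm => rw [countA_succ]; omega
      have hjk : j < k := by
        rcases j with _ | m
        · exact hk
        · have := hpos m; omega
      obtain ⟨b1, b2⟩ := ih j hjk
      rcases hj with hj | hj
      · have hc : countA k = j := by rw [hj, countA_add_countA]
        have hk' : (k : ℝ) + 1 = countA j + j + 1 := by rw [hj]; push_cast; ring
        rw [← hk'] at b1 b2
        rw [hc]
        constructor <;> nlinarith
      · have hc : countA k = j + 1 := by rw [hj, countA_add_countA_succ]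
        have hk' : (k : ℝ) = countA j + j + 1 := by rw [hj]; push_cast; ring
        rw [← hk'] at b1 b2
        rw [hc]; push_cast
        constructor <;> nlinarith

theorem chain_natCast (k : ℕ) :
    chain k = k + (Real.goldenRatio - 1) * countA k := by
  induction k with
  | zero => simp [chain_zero, countA_zero]
  | succ k ih =>
    have h := chain_rec ((k + 1 : ℕ) : ℤ)
    rw [show ((k + 1 : ℕ) : ℤ) - 1 = k by push_cast; ring, ih] at h
    rw [h, countA_succ]
    have h2 : twoSided (k : ℤ) = oneSided k := rfl
    rw [h2]
    cases oneSided k <;> simp [len] <;> ring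

/-- The two-sided word is a mirror image of itself outside the inserted block `ba`, whose length is
`τ ^ 2`. -/
theorem chain_neg_two_sub (k : ℕ) :
    chain (-2 - k) = -Real.goldenRatio ^ 2 - chain k := by
  induction k with
  | zero =>
    have h1 := chain_rec 0
    have h2 := chain_rec (-1)
    have h3 : len (twoSided (0 - 1)) = Real.goldenRatio := rfl
    have h4 : len (twoSided (-1 - 1)) = 1 := rfl
    rw [h3, chain_zero] at h1
    rw [h4] at h2
    norm_num at h1 h2 ⊢
    rw [chain_zero]
    linarith
  | succ k ih =>
    have h1 := chain_rec (-2 - k)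
    have h2 := chain_rec ((k + 1 : ℕ) : ℤ)
    have h3 : twoSided (((k + 1 : ℕ) : ℤ) - 1) = oneSided k := by
      rw [show ((k + 1 : ℕ) : ℤ) - 1 = k by push_cast; ring]; rfl
    have h4 : twoSided (-2 - (k : ℤ) - 1) = oneSided k := by
      rw [show -2 - (k : ℤ) - 1 = Int.negSucc (k + 2) by rw [Int.negSucc_eq]; push_cast; ring]
      rfl
    rw [h3, show ((k + 1 : ℕ) : ℤ) - 1 = k by push_cast; ring] at h2
    rw [h4, ih] at h1
    rw [show -2 - ((k + 1 : ℕ) : ℤ) = -2 - (k : ℤ) - 1 by push_cast; ring]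
    linarith

/-- The Beatty-type sequence underlying the Fibonacci chain. -/
noncomputable def beatty (k : ℤ) : ℤ := ⌈((k : ℝ) + 1) * Real.goldenRatio⌉

theorem chain_eq (k : ℤ) :
    chain k = k + (Real.goldenRatio - 1) * ((beatty k : ℝ) - k - 2) := by
  have hτ := Real.goldenRatio_sq
  have hτ1 := goldenRatio_gt
  have key : ∀ n : ℕ, beatty n = countA n + n + 2 := by
    intro n
    obtain ⟨h1, h2⟩ := countA_bounds n
    rw [beatty, Int.ceil_eq_iff]
    push_cast
    constructor <;> linarith
  rcases lt_or_ge k 0 with hk | hk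
  · rcases eq_or_ne k (-1) with rfl | hk1
    · have h1 := chain_rec 0
      have h3 : len (twoSided (0 - 1)) = Real.goldenRatio := rfl
      rw [h3, chain_zero] at h1
      have h2 : beatty (-1) = 0 := by simp [beatty]
      rw [h2]; norm_num at h1 ⊢; linarith
    · obtain ⟨n, rfl⟩ : ∃ n : ℕ, k = -2 - n := ⟨(-2 - k).toNat, by omega⟩
      have h3 : beatty (-2 - n) = -(countA n + n + 1) := by
        obtain ⟨h1, h2⟩ := countA_bounds n
        rw [beatty, Int.ceil_eq_iff]
        push_cast
        constructor <;> linarith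
      rw [chain_neg_two_sub, chain_natCast, h3]
      push_cast
      nlinarith
  · obtain ⟨n, rfl⟩ := Int.eq_ofNat_of_zero_le hk
    rw [chain_natCast, key]; push_cast; ring

/-! ### Spacing of the chain and the nearest chain point -/

theorem one_le_len (l : Letter) : 1 ≤ len l := by
  have := goldenRatio_gt
  cases l <;> simp only [len] <;> linarith

theorem len_le (l : Letter) : len l ≤ Real.goldenRatio := by
  have := goldenRatio_gt
  cases l <;> simp only [len] <;> linarith

theorem chain_succ (k : ℤ) : chain (k + 1) = chain k + len (twoSided k) := by
  have := chain_rec (k + 1)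
  rwa [show k + 1 - 1 = k by ring] at this

theorem chain_succ_ge (k : ℤ) : chain k + 1 ≤ chain (k + 1) := by
  rw [chain_succ]; linarith [one_le_len (twoSided k)]

theorem chain_succ_le (k : ℤ) : chain (k + 1) ≤ chain k + Real.goldenRatio := by
  rw [chain_succ]; linarith [len_le (twoSided k)]

theorem chain_sub_ge {k l : ℤ} (h : k ≤ l) : (l : ℝ) - k ≤ chain l - chain k := by
  induction l, h using Int.leInduction with
  | base => simp
  | succ l _ ih => push_cast; linarith [chain_succ_ge l]

theorem chain_strictMono : StrictMono chain := by
  intro k l h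
  have h1 := chain_sub_ge h.le
  have h2 : (k : ℝ) < l := by exact_mod_cast h
  linarith

theorem chain_le_sub_one {k l : ℤ} (h : k < l) : chain k ≤ chain l - 1 := by
  have h1 := chain_sub_ge h.le
  have h2 : (k : ℝ) + 1 ≤ l := by exact_mod_cast h
  linarith

/-- The average length of the tiles of the chain. -/
noncomputable def meanLen : ℝ := 1 + (Real.goldenRatio - 1) ^ 2

theorem abs_chain_sub_le (k : ℤ) : |chain k - meanLen * k| ≤ 1 := by
  have h1 := Int.le_ceil (((k : ℝ) + 1) * Real.goldenRatio)
  have h2 := Int.ceil_lt_add_one (((k : ℝ) + 1) * Real.goldenRatio)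
  have hτ1 := goldenRatio_gt
  have hτ2 := goldenRatio_lt
  rw [chain_eq, beatty, meanLen]
  set b : ℝ := (⌈((k : ℝ) + 1) * Real.goldenRatio⌉ : ℝ)
  set τ := Real.goldenRatio
  have h3 : (k : ℝ) + (τ - 1) * (b - k - 2) - (1 + (τ - 1) ^ 2) * k
      = (τ - 1) * ((b - (k + 1) * τ) + τ - 2) := by ring
  rw [h3, abs_le]
  constructor <;> nlinarith

theorem exists_chain_le (x : ℝ) : ∃ k : ℤ, chain k ≤ x ∧ x < chain (k + 1) := by
  obtain ⟨k, hk, hmax⟩ := Int.exists_greatest_of_bdd (P := fun k => chain k ≤ x)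
    ⟨⌈|x|⌉, by
      intro k hk
      by_contra hc
      push Not at hc
      have h0 : (0 : ℤ) ≤ ⌈|x|⌉ := Int.ceil_nonneg (abs_nonneg x)
      have h1 := chain_sub_ge (show (0 : ℤ) ≤ k by omega)
      rw [chain_zero] at h1
      have h2 := Int.le_ceil |x|
      have h3 : ((⌈|x|⌉ : ℤ) : ℝ) < k := by exact_mod_cast hc
      push_cast at h1
      linarith [le_abs_self x]⟩
    ⟨-⌈|x|⌉, by
      have h0 : (0 : ℤ) ≤ ⌈|x|⌉ := Int.ceil_nonneg (abs_nonneg x)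
      have h1 := chain_sub_ge (show -⌈|x|⌉ ≤ (0 : ℤ) by omega)
      rw [chain_zero] at h1
      have h2 := Int.le_ceil |x|
      push_cast at h1
      linarith [neg_abs_le x]⟩
  refine ⟨k, hk, ?_⟩
  by_contra hc
  push Not at hc
  have := hmax (k + 1) hc
  omega

theorem alphaPos_eq {x : ℝ} {k : ℤ} (h1 : chain k ≤ x) (h2 : x < chain (k + 1)) :
    alphaPos x = chain k := by
  refine IsLUB.csSup_eq (IsGreatest.isLUB ⟨⟨⟨k, rfl⟩, h1⟩, ?_⟩) ⟨_, ⟨k, rfl⟩, h1⟩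
  rintro _ ⟨⟨l, rfl⟩, hl⟩
  have h3 : l < k + 1 := chain_strictMono.lt_iff_lt.1 (hl.trans_lt h2)
  exact chain_strictMono.monotone (by omega)

theorem betaPos_eq {x : ℝ} {k : ℤ} (h1 : chain k ≤ x) (h2 : x < chain (k + 1)) :
    betaPos x = chain (k + 1) := by
  refine IsGLB.csInf_eq (IsLeast.isGLB ⟨⟨⟨k + 1, rfl⟩, h2⟩, ?_⟩) ⟨_, ⟨k + 1, rfl⟩, h2⟩
  rintro _ ⟨⟨l, rfl⟩, hl⟩
  have h3 : k < l := chain_strictMono.lt_iff_lt.1 (h1.trans_lt hl)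
  exact chain_strictMono.monotone (by omega)

/-- The middle branch of `alpha` and `beta` reflects points up to `τ ^ 2 = chain 2`, whose right
neighbour has index 3; no further symmetry about 0 is needed. -/
theorem chain_neg {k : ℤ} (h0 : 0 ≤ k) (h3 : k ≤ 3) : chain (-k) = -chain k := by
  have e0 := chain_zero
  have e1 := chain_succ 0
  have e2 := chain_succ 1
  have e3 := chain_succ 2
  have f1 := chain_succ (-1)
  have f2 := chain_succ (-2)
  have f3 := chain_succ (-3)
  rw [show len (twoSided 0) = Real.goldenRatio from rfl] at e1
  rw [show len (twoSided 1) = 1 from rfl] at e2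
  rw [show len (twoSided 2) = Real.goldenRatio from rfl] at e3
  rw [show len (twoSided (-1)) = Real.goldenRatio from rfl] at f1
  rw [show len (twoSided (-2)) = 1 from rfl] at f2
  rw [show len (twoSided (-3)) = Real.goldenRatio from rfl] at f3
  norm_num at e1 e2 e3 f1 f2 f3
  interval_cases k <;> norm_num <;> linarith

/-- The reflections in the definitions carry neighbours to neighbours in the chain itself. They also
interchange `≤` and `<`, so only weak inequalities hold on both sides. -/
theorem exists_alpha_beta (x : ℝ) : ∃ k : ℤ, alpha x = chain k ∧ beta x = chain (k + 1) ∧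
    chain k ≤ x ∧ x ≤ chain (k + 1) := by
  have hsq : chain 2 = Real.goldenRatio ^ 2 := by
    have e1 := chain_succ 0
    have e2 := chain_succ 1
    rw [show len (twoSided 0) = Real.goldenRatio from rfl, chain_zero] at e1
    rw [show len (twoSided 1) = 1 from rfl] at e2
    rw [Real.goldenRatio_sq]
    norm_num at e1 e2
    linarith
  rcases le_or_gt 0 x with hx | hx
  · obtain ⟨k, h1, h2⟩ := exists_chain_le x
    exact ⟨k, by rw [alpha, if_pos hx, alphaPos_eq h1 h2], by rw [beta, if_pos hx,
      betaPos_eq h1 h2], h1, h2.le⟩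
  · by_cases hx2 : -Real.goldenRatio ^ 2 ≤ x
    · obtain ⟨k, h1, h2⟩ := exists_chain_le (-x)
      have hk0 : 0 < k + 1 := by
        rw [← chain_strictMono.lt_iff_lt, chain_zero]; linarith
      have hk2 : k ≤ 2 := by
        rw [← chain_strictMono.le_iff_le, hsq]; linarith
      have e1 := chain_neg (k := k) (by omega) (by omega)
      have e2 := chain_neg (k := k + 1) (by omega) (by omega)
      refine ⟨-(k + 1), ?_, ?_, ?_, ?_⟩
      · rw [alpha, if_neg hx.not_ge, if_pos hx2, betaPos_eq h1 h2, e2]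
      · rw [beta, if_neg hx.not_ge, if_pos hx2, alphaPos_eq h1 h2,
          show -(k + 1) + 1 = -k by ring, e1]
      · rw [e2]; linarith
      · rw [show -(k + 1) + 1 = -k by ring, e1]; linarith
    · obtain ⟨k, h1, h2⟩ := exists_chain_le (-x - Real.goldenRatio ^ 2)
      have hk0 : 0 < k + 1 := by
        rw [← chain_strictMono.lt_iff_lt, chain_zero]; linarith
      obtain ⟨n, rfl⟩ := Int.eq_ofNat_of_zero_le (show 0 ≤ k by omega)
      have e1 := chain_neg_two_sub n
      have e2 := chain_neg_two_sub (n + 1)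
      push_cast at e2
      refine ⟨-2 - (n + 1), ?_, ?_, ?_, ?_⟩
      · rw [alpha, if_neg hx.not_ge, if_neg hx2, betaPos_eq h1 h2, e2]; ring
      · rw [beta, if_neg hx.not_ge, if_neg hx2, alphaPos_eq h1 h2,
          show -2 - ((n : ℤ) + 1) + 1 = -2 - n by ring, e1]; ring
      · rw [e2]; linarith
      · rw [show -2 - ((n : ℤ) + 1) + 1 = -2 - n by ring, e1]; linarith

theorem exists_nearest_eq (x : ℝ) : ∃ k : ℤ, nearest x = chain k := by
  obtain ⟨k, h1, h2, -⟩ := exists_alpha_beta x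
  rw [nearest]
  split_ifs
  · exact ⟨k, h1⟩
  · exact ⟨k + 1, h2⟩

theorem abs_sub_nearest_le (x : ℝ) : |x - nearest x| ≤ Real.goldenRatio / 2 := by
  obtain ⟨k, h1, h2, h3, h4⟩ := exists_alpha_beta x
  have h5 := chain_succ_le k
  rw [nearest]
  split_ifs with h
  · rw [h1, h2] at h; rw [h1, abs_le]; constructor <;> linarith
  · rw [h1, h2] at h; rw [h2, abs_le]; constructor <;> linarith

theorem nearest_eq {x : ℝ} {k : ℤ} (h : |x - chain k| < 1 / 2) : nearest x = chain k := by
  obtain ⟨l, h1, h2, h3, h4⟩ := exists_alpha_beta x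
  have h5 := chain_succ_ge l
  rw [abs_lt] at h
  rcases lt_trichotomy k l with hk | rfl | hk
  · have := chain_le_sub_one hk; linarith
  · rw [nearest, h1, h2, if_pos]; linarith
  · rcases eq_or_ne k (l + 1) with rfl | hk2
    · rw [nearest, h1, h2, if_neg]; linarith
    · have := chain_le_sub_one (show l + 1 < k by omega); linarith

/-! ### The potential -/

theorem zeta_eq_zero {x : ℝ} (h : 1 / 3 ≤ |x|) : zeta x = 0 := by
  rw [zeta, if_neg (by linarith), if_neg (by linarith)]

theorem zeta_nonneg (x : ℝ) : 0 ≤ zeta x := by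
  rw [zeta]
  split_ifs with h1 h2
  · rw [abs_le] at h1; nlinarith
  · have : 0 ≤ 96 * |x| - 11 := by linarith
    positivity
  · exact le_rfl

theorem differentiable_max_zero_sq : Differentiable ℝ fun t : ℝ => (max t 0) ^ 2 := by
  intro t
  rcases lt_trichotomy t 0 with ht | rfl | ht
  · refine (differentiableAt_const (0 : ℝ)).congr_of_eventuallyEq ?_
    filter_upwards [gt_mem_nhds ht] with s hs
    simp [max_eq_right hs.le]
  · have h : (fun t : ℝ => (max t 0) ^ 2) =O[𝓝 0] fun t => ‖t - 0‖ ^ 2 := by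
      refine Asymptotics.IsBigO.of_bound 1 (Eventually.of_forall fun s => ?_)
      simp only [sub_zero, norm_pow, norm_norm, one_mul]
      refine pow_le_pow_left₀ (norm_nonneg _) ?_ 2
      rw [Real.norm_eq_abs, Real.norm_eq_abs, abs_of_nonneg (le_max_right _ _)]
      exact max_le (le_abs_self s) (abs_nonneg s)
    exact (h.hasFDerivAt (by norm_num)).differentiableAt
  · refine (differentiableAt_id.pow 2).congr_of_eventuallyEq ?_
    filter_upwards [lt_mem_nhds ht] with s hs
    simp [max_eq_left (le_of_lt hs)]

/-- Truncated powers, one group for each sign of `x`, make differentiability at the joints `1/4` and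
`1/3` automatic. The cubes are split as a truncated square times a linear factor, so
`differentiable_max_zero_sq` suffices. -/
theorem zeta_eq_spline (x : ℝ) : zeta x = -64 * x ^ 2 + 160 / 27
    + (2048 * ((max (x - 1 / 4) 0) ^ 2 * (x - 1 / 4)) - 2048 * ((max (x - 1 / 3) 0) ^ 2 * (x - 1 / 3))
      - 448 * (max (x - 1 / 3) 0) ^ 2)
    + (2048 * ((max (-x - 1 / 4) 0) ^ 2 * (-x - 1 / 4))
      - 2048 * ((max (-x - 1 / 3) 0) ^ 2 * (-x - 1 / 3)) - 448 * (max (-x - 1 / 3) 0) ^ 2) := by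
  rw [zeta]
  rcases le_total 0 x with h | h
  · rw [abs_of_nonneg h, max_eq_right (show -x - 1 / 4 ≤ 0 by linarith),
      max_eq_right (show -x - 1 / 3 ≤ 0 by linarith)]
    split_ifs with h1 h2
    · rw [max_eq_right (show x - 1 / 4 ≤ 0 by linarith),
        max_eq_right (show x - 1 / 3 ≤ 0 by linarith)]
      ring
    · rw [max_eq_left (show 0 ≤ x - 1 / 4 by linarith),
        max_eq_right (show x - 1 / 3 ≤ 0 by linarith)]
      ring
    · rw [max_eq_left (show 0 ≤ x - 1 / 4 by linarith),
        max_eq_left (show 0 ≤ x - 1 / 3 by linarith)]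
      ring
  · rw [abs_of_nonpos h, max_eq_right (show x - 1 / 4 ≤ 0 by linarith),
      max_eq_right (show x - 1 / 3 ≤ 0 by linarith)]
    split_ifs with h1 h2
    · rw [max_eq_right (show -x - 1 / 4 ≤ 0 by linarith),
        max_eq_right (show -x - 1 / 3 ≤ 0 by linarith)]
      ring
    · rw [max_eq_left (show 0 ≤ -x - 1 / 4 by linarith),
        max_eq_right (show -x - 1 / 3 ≤ 0 by linarith)]
      ring
    · rw [max_eq_left (show 0 ≤ -x - 1 / 4 by linarith),
        max_eq_left (show 0 ≤ -x - 1 / 3 by linarith)]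
      ring

theorem differentiable_zeta : Differentiable ℝ zeta := by
  have h1 : ∀ c : ℝ, Differentiable ℝ fun x : ℝ => (max (x - c) 0) ^ 2 := fun c =>
    differentiable_max_zero_sq.comp (differentiable_id.sub_const c)
  have h2 : ∀ c : ℝ, Differentiable ℝ fun x : ℝ => (max (-x - c) 0) ^ 2 := fun c =>
    differentiable_max_zero_sq.comp (differentiable_id.neg.sub_const c)
  have h3 := h1 (1 / 4)
  have h4 := h1 (1 / 3)
  have h5 := h2 (1 / 4)
  have h6 := h2 (1 / 3)
  rw [show zeta = _ from funext zeta_eq_spline]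
  fun_prop

theorem V_nonneg (x : ℝ) : 0 ≤ V x := zeta_nonneg _

theorem V_eq_zeta {x : ℝ} {k : ℤ} (h : |x - chain k| < 1 / 2) : V x = zeta (x - chain k) := by
  rw [V, nearest_eq h]

theorem V_eq_zero {x : ℝ} (h : ∀ k : ℤ, 1 / 3 ≤ |x - chain k|) : V x = 0 := by
  obtain ⟨k, hk⟩ := exists_nearest_eq x
  rw [V, hk, zeta_eq_zero (h k)]

theorem differentiable_V : Differentiable ℝ V := by
  intro x
  by_cases h : ∃ k : ℤ, |x - chain k| < 1 / 2
  · obtain ⟨k, hk⟩ := h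
    have h1 : DifferentiableAt ℝ (fun y => zeta (y - chain k)) x :=
      (differentiable_zeta _).comp x (differentiableAt_id.sub_const _)
    refine h1.congr_of_eventuallyEq ?_
    have h2 : ∀ᶠ y in 𝓝 x, |y - chain k| < 1 / 2 :=
      (by fun_prop : Continuous fun y : ℝ => |y - chain k|).continuousAt.eventually_lt_const hk
    filter_upwards [h2] with y hy using V_eq_zeta hy
  · push Not at h
    refine (differentiableAt_const (0 : ℝ)).congr_of_eventuallyEq ?_
    filter_upwards [Metric.ball_mem_nhds x (show (0 : ℝ) < 1 / 6 by norm_num)] with y hy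
    refine V_eq_zero fun k => ?_
    rw [Metric.mem_ball, Real.dist_eq] at hy
    have h1 := h k
    have h2 := abs_sub_le x y (chain k)
    rw [abs_sub_comm x y] at h2
    linarith

theorem exists_V_eq_zero_near (y : ℝ) : ∃ z, |z - y| ≤ 1 / 3 ∧ V z = 0 := by
  by_cases h : ∃ k : ℤ, |y - chain k| < 1 / 3
  · obtain ⟨k, hk⟩ := h
    rw [abs_lt] at hk
    rcases le_total (chain k) y with hy | hy
    · refine ⟨chain k + 1 / 3, by rw [abs_le]; constructor <;> linarith, ?_⟩
      rw [V_eq_zeta (k := k) (by norm_num), zeta_eq_zero (by norm_num)]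
    · refine ⟨chain k - 1 / 3, by rw [abs_le]; constructor <;> linarith, ?_⟩
      rw [V_eq_zeta (k := k) (by norm_num), zeta_eq_zero (by norm_num)]
  · push Not at h
    exact ⟨y, by norm_num, V_eq_zero h⟩

theorem mem_Icc_of_near {k l t : ℤ} {y : ℝ} (h1 : chain k ≤ y) (h2 : y ≤ chain l)
    (ht : |y - chain t| < 1 / 2) : k ≤ t ∧ t ≤ l := by
  rw [abs_lt] at ht
  constructor
  · by_contra hc
    have := chain_le_sub_one (show t < k by omega); linarith
  · by_contra hc
    have := chain_le_sub_one (show l < t by omega); linarith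

/-- Where the chain repeats itself up to a translation, so does the potential. -/
theorem V_add_eq {k l s : ℤ} {T : ℝ} (hT : ∀ t, k ≤ t → t ≤ l → chain (t + s) = chain t + T)
    {y : ℝ} (h1 : chain k ≤ y) (h2 : y ≤ chain l) : V (y + T) = V y := by
  have hkl : k ≤ l := chain_strictMono.le_iff_le.1 (h1.trans h2)
  by_cases h : ∃ t : ℤ, |y - chain t| < 1 / 2
  · obtain ⟨t, ht⟩ := h
    obtain ⟨h3, h4⟩ := mem_Icc_of_near h1 h2 ht
    have h5 : y + T - chain (t + s) = y - chain t := by rw [hT t h3 h4]; ring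
    rw [V_eq_zeta ht, V_eq_zeta (k := t + s) (by rwa [h5]), h5]
  · push Not at h
    rw [V_eq_zero fun k => (by norm_num : (1 / 3 : ℝ) ≤ 1 / 2).trans (h k), V_eq_zero]
    intro t
    by_contra hc
    have hk := hT k le_rfl hkl
    have hl := hT l hkl le_rfl
    obtain ⟨h3, h4⟩ := mem_Icc_of_near (k := k + s) (l := l + s) (y := y + T) (t := t)
      (by linarith) (by linarith) (by linarith)
    have h5 := hT (t - s) (by omega) (by omega)
    rw [show t - s + s = t by ring] at h5
    have h6 := h (t - s)
    rw [h5, show y + T - (chain (t - s) + T) = y - chain (t - s) by ring] at hc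
    linarith

/-! ### Finite segments of least energy -/

/-- The energy of the segment `(x_i, …, x_j)` of a sequence. -/
noncomputable def segE (W : ℝ → ℝ) (x : ℕ → ℝ) (i j : ℕ) : ℝ :=
  ∑ t ∈ Finset.Ico i j, fkH W (x t) (x (t + 1))

theorem segE_add (W : ℝ → ℝ) (x : ℕ → ℝ) {i j k : ℕ} (hij : i ≤ j) (hjk : j ≤ k) :
    segE W x i j + segE W x j k = segE W x i k :=
  Finset.sum_Ico_consecutive _ hij hjk

theorem segE_succ (W : ℝ → ℝ) (x : ℕ → ℝ) (i : ℕ) :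
    segE W x i (i + 1) = fkH W (x i) (x (i + 1)) := by
  simp [segE]

/-- There is a segment with `n` steps from `a` to `b` of energy `e`. -/
def HasPath (W : ℝ → ℝ) (n : ℕ) (a b e : ℝ) : Prop :=
  ∃ y : ℕ → ℝ, y 0 = a ∧ y n = b ∧ segE W y 0 n = e

theorem HasPath.single (W : ℝ → ℝ) (a b : ℝ) : HasPath W 1 a b (fkH W a b) :=
  ⟨fun i => if i = 0 then a else b, by simp, by simp, by simp [segE]⟩

theorem HasPath.append {W : ℝ → ℝ} {n m : ℕ} {a b c e f : ℝ} (h1 : HasPath W n a b e)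
    (h2 : HasPath W m b c f) : HasPath W (n + m) a c (e + f) := by
  obtain ⟨y, rfl, rfl, rfl⟩ := h1
  obtain ⟨z, hz, rfl, rfl⟩ := h2
  refine ⟨fun i => if i ≤ n then y i else z (i - n), by simp, ?_, ?_⟩
  · rcases Nat.eq_zero_or_pos m with rfl | hm
    · simp [hz]
    · simp [hm.ne']
  · rw [← segE_add W _ (Nat.zero_le n) (Nat.le_add_right n m)]
    congr 1
    · refine Finset.sum_congr rfl fun t ht => ?_
      rw [Finset.mem_Ico] at ht
      simp only [if_pos (show t ≤ n by omega), if_pos (show t + 1 ≤ n by omega)]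
    · rw [segE, segE, Finset.sum_Ico_eq_sum_range, Nat.Ico_zero_eq_range]
      rw [show n + m - n = m by omega]
      refine Finset.sum_congr rfl fun t _ => ?_
      rw [if_neg (show ¬ (n + t + 1 ≤ n) by omega), show n + t + 1 - n = t + 1 by omega]
      congr 1
      split_ifs with h
      · obtain rfl : t = 0 := by omega
        simp [hz]
      · congr 1; omega

theorem HasPath.of_seq_add {W : ℝ → ℝ} {x : ℕ → ℝ} {i j : ℕ} (hij : i ≤ j) {T : ℝ}
    (hT : ∀ t, i ≤ t → t < j → W (x t + T) = W (x t)) :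
    HasPath W (j - i) (x i + T) (x j + T) (segE W x i j) := by
  refine ⟨fun t => x (i + t) + T, by simp, by simp [hij], ?_⟩
  rw [segE, segE, Nat.Ico_zero_eq_range, Finset.sum_Ico_eq_sum_range]
  refine Finset.sum_congr rfl fun t ht => ?_
  rw [Finset.mem_range] at ht
  simp only [fkH, hT (i + t) (by omega) (by omega), ← add_assoc]
  ring

theorem HasPath.of_seq (W : ℝ → ℝ) (x : ℕ → ℝ) {i j : ℕ} (hij : i ≤ j) :
    HasPath W (j - i) (x i) (x j) (segE W x i j) := by
  simpa using HasPath.of_seq_add (W := W) (x := x) hij (T := 0) (by simp)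

theorem HasPath.cast {W : ℝ → ℝ} {n m : ℕ} {a b a' b' e e' : ℝ} (h : HasPath W n a b e)
    (hn : n = m) (ha : a = a') (hb : b = b') (he : e = e') : HasPath W m a' b' e' := by
  subst hn ha hb he; exact h

/-- The potential is charged at every point but the last, so reversal only changes which end point
is charged. -/
theorem HasPath.reverse {W : ℝ → ℝ} {n : ℕ} {a b e : ℝ} (h : HasPath W n a b e) :
    HasPath W n b a (e - W a + W b) := by
  induction n generalizing b e with
  | zero =>
    obtain ⟨y, rfl, h2, rfl⟩ := h
    exact ⟨y, h2, rfl, by rw [← h2]; simp [segE]⟩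
  | succ n ih =>
    obtain ⟨y, rfl, rfl, rfl⟩ := h
    have h1 := ih (HasPath.of_seq W y (Nat.zero_le n))
    refine ((HasPath.single W (y (n + 1)) (y n)).append h1).cast (by omega) rfl rfl ?_
    rw [← segE_add W y (Nat.zero_le n) (Nat.le_succ n), segE_succ]
    simp only [fkH]
    ring

/-- The segment `(x_0, …, x_n)` has the least energy among those with the same end points. -/
def IsMinSeg (W : ℝ → ℝ) (n : ℕ) (x : ℕ → ℝ) : Prop :=
  ∀ e, HasPath W n (x 0) (x n) e → segE W x 0 n ≤ e

theorem IsMinSeg.replace {W : ℝ → ℝ} {n : ℕ} {x : ℕ → ℝ} (hx : IsMinSeg W n x) {s t : ℕ} {e : ℝ}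
    (hst : s ≤ t) (htn : t ≤ n) (h : HasPath W (t - s) (x s) (x t) e) : segE W x s t ≤ e := by
  have h1 := ((HasPath.of_seq W x (Nat.zero_le s)).append h).append (HasPath.of_seq W x htn)
  have h2 := hx _ (h1.cast (by omega) rfl rfl rfl)
  have h3 := segE_add W x (Nat.zero_le s) hst
  have h4 := segE_add W x (Nat.zero_le t) htn
  linarith

/-- Two disjoint pieces of a segment of least energy cannot be replaced by pieces with the same
total number of steps and less energy. -/
theorem IsMinSeg.exchange {W : ℝ → ℝ} {n : ℕ} {x : ℕ → ℝ} (hx : IsMinSeg W n x)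
    {s₁ t₁ s₂ t₂ n₁ n₂ : ℕ} {e₁ e₂ : ℝ} (h₁ : s₁ ≤ t₁) (h₂ : s₂ ≤ t₂) (hn₁ : t₁ ≤ n)
    (hn₂ : t₂ ≤ n) (hdisj : t₁ ≤ s₂ ∨ t₂ ≤ s₁) (p₁ : HasPath W n₁ (x s₁) (x t₁) e₁)
    (p₂ : HasPath W n₂ (x s₂) (x t₂) e₂) (hlen : n₁ + n₂ = (t₁ - s₁) + (t₂ - s₂)) :
    segE W x s₁ t₁ + segE W x s₂ t₂ ≤ e₁ + e₂ := by
  wlog h : t₁ ≤ s₂ generalizing s₁ t₁ s₂ t₂ n₁ n₂ e₁ e₂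
  · have := this h₂ h₁ hn₂ hn₁ hdisj.symm p₂ p₁ (by omega) (hdisj.resolve_left h)
    linarith
  have h1 := (p₁.append (HasPath.of_seq W x h)).append p₂
  have h2 := hx.replace (by omega) hn₂ (h1.cast (by omega) rfl rfl rfl)
  have h3 := segE_add W x h₁ h
  have h4 := segE_add W x (h₁.trans h) h₂
  linarith

/-- Minimize over the compact box with entries in `[a, b]`. Arbitrary competitors may be truncated
to the box: this shortens the steps, and the entries that move land on `a` or `b`, where `W` has its
least value 0. -/
theorem exists_isMinSeg {W : ℝ → ℝ} (hW : Continuous W) (hW0 : ∀ x, 0 ≤ W x) {a b : ℝ}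
    (hab : a ≤ b) (ha : W a = 0) (hb : W b = 0) {n : ℕ} (hn : 0 < n) :
    ∃ x : ℕ → ℝ, x 0 = a ∧ x n = b ∧ (∀ i, x i ∈ Set.Icc a b) ∧ IsMinSeg W n x := by
  set K : Set (ℕ → ℝ) := Set.univ.pi (fun _ => Set.Icc a b) ∩ {x | x 0 = a ∧ x n = b} with hK
  have hKc : IsCompact K := by
    refine (isCompact_univ_pi fun _ => isCompact_Icc).inter_right ?_
    exact (isClosed_eq (continuous_apply 0) continuous_const).inter
      (isClosed_eq (continuous_apply n) continuous_const)
  have hKn : K.Nonempty := by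
    refine ⟨fun i => if i = 0 then a else b, fun i _ => ?_, by simp, by simp [hn.ne']⟩
    simp only
    split_ifs
    · exact ⟨le_rfl, hab⟩
    · exact ⟨hab, le_rfl⟩
  have hcont : Continuous fun x : ℕ → ℝ => segE W x 0 n := by
    unfold segE fkH
    fun_prop
  obtain ⟨x, hxK, hmin⟩ := hKc.exists_isMinOn hKn hcont.continuousOn
  refine ⟨x, hxK.2.1, hxK.2.2, fun i => hxK.1 i trivial, ?_⟩
  rintro _ ⟨y, hy0, hyn, rfl⟩
  rw [hxK.2.1] at hy0
  rw [hxK.2.2] at hyn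
  have hyK : (fun i => max a (min b (y i))) ∈ K := by
    refine ⟨fun i _ => ⟨le_max_left _ _, max_le hab (min_le_left _ _)⟩, ?_, ?_⟩
    · simp [hy0, hab]
    · simp [hyn, hab]
  refine (hmin hyK).trans (Finset.sum_le_sum fun i _ => ?_)
  have h1 : W (max a (min b (y i))) ≤ W (y i) := by
    rcases le_total b (y i) with h | h
    · rw [min_eq_left h, max_eq_right hab, hb]; exact hW0 _
    · rw [min_eq_right h]
      rcases le_total a (y i) with h' | h'
      · rw [max_eq_right h']
      · rw [max_eq_left h', ha]; exact hW0 _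
  have h2 : |max a (min b (y i)) - max a (min b (y (i + 1)))| ≤ |y i - y (i + 1)| := by
    refine (abs_max_sub_max_le_max _ _ _ _).trans ?_
    refine max_le (by simp) ((abs_min_sub_min_le_max _ _ _ _).trans (max_le (by simp) le_rfl))
  have h3 := sq_le_sq.2 h2
  simp only [fkH]
  linarith

/-- A segment of least energy which stays between its end points is monotone: otherwise
reversing a piece of it would lower the energy. -/
theorem IsMinSeg.le_succ {W : ℝ → ℝ} {n : ℕ} {x : ℕ → ℝ} (hx : IsMinSeg W n x)
    (h0 : ∀ i ≤ n, x 0 ≤ x i) (hn : ∀ i ≤ n, x i ≤ x n) {q : ℕ} (hq : q < n) :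
    x q ≤ x (q + 1) := by
  classical
  by_contra hc
  push Not at hc
  -- `j` is the last index below the level `x q`, and `i + 1` will be the first index above the
  -- level `x j`; the piece from `i + 1` to `j` is reversed.
  set j := Nat.findGreatest (fun j => x j < x q) n with hj
  have hjq : q + 1 ≤ j := Nat.le_findGreatest (P := fun j => x j < x q) hq hc
  have hjx : x j < x q := Nat.findGreatest_spec (P := fun j => x j < x q) hq hc
  have hjn' : j ≤ n := Nat.findGreatest_le n
  have hjn : j < n := by
    rcases hjn'.lt_or_eq with h | h
    · exact h
    · rw [h] at hjx; linarith [hn q hq.le]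
  have hj1 : x q ≤ x (j + 1) := by
    by_contra h
    push Not at h
    have := Nat.le_findGreatest (P := fun j => x j < x q) (show j + 1 ≤ n by omega) h
    omega
  have hex : ∃ i, x j < x i := ⟨q, hjx⟩
  obtain ⟨i, hi⟩ : ∃ i, Nat.find hex = i + 1 := by
    refine Nat.exists_eq_succ_of_ne_zero fun h => ?_
    have := Nat.find_spec hex
    rw [h] at this
    linarith [h0 j hjn']
  have hi1 : x j < x (i + 1) := hi ▸ Nat.find_spec hex
  have hi2 : x i ≤ x j := not_lt.1 (Nat.find_min hex (by omega))
  have hiq : i + 1 ≤ q := hi ▸ Nat.find_min' hex hjx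
  have hij : i + 1 ≤ j := by omega
  have p := ((HasPath.single W (x i) (x j)).append (HasPath.of_seq W x hij).reverse).append
    (HasPath.single W (x (i + 1)) (x (j + 1)))
  have h1 := hx.replace (show i ≤ j + 1 by omega) (by omega) (p.cast (by omega) rfl rfl rfl)
  have h2 := segE_add W x (show i ≤ i + 1 by omega) hij
  have h3 := segE_add W x (show i ≤ j by omega) (show j ≤ j + 1 by omega)
  rw [segE_succ] at h2 h3
  -- This product is exactly the energy change caused by the reversal.
  have h4 : (x i - x (j + 1)) * (x (i + 1) - x j) < 0 :=
    mul_neg_of_neg_of_pos (by linarith) (by linarith)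
  simp only [fkH] at h1 h2 h3
  nlinarith

/-- Moving the point `x_{i+1}` into the gap between `x_j` and `x_{j+1}` does not pay off. -/
theorem IsMinSeg.move_le {W : ℝ → ℝ} {n : ℕ} {x : ℕ → ℝ} (hx : IsMinSeg W n x)
    (hW0 : ∀ x, 0 ≤ W x) {i j : ℕ} (hi : i + 2 ≤ n) (hj : j + 1 ≤ n)
    (hdisj : i + 2 ≤ j ∨ j + 1 ≤ i) {z : ℝ} (hz : W z = 0) :
    (x (j + 1) - z) * (z - x j) ≤ (x (i + 1) - x i) * (x (i + 2) - x (i + 1)) := by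
  -- Since `(a + b) ^ 2 / 2 - a ^ 2 / 2 - b ^ 2 / 2 = a * b`, removing a point costs the product of
  -- its adjacent gaps and inserting one gains such a product.
  have h1 := hx.exchange (show i ≤ i + 2 by omega) (show j ≤ j + 1 by omega) hi hj hdisj
    (HasPath.single W (x i) (x (i + 2)))
    ((HasPath.single W (x j) z).append (HasPath.single W z (x (j + 1)))) (by omega)
  have h2 := segE_add W x (show i ≤ i + 1 by omega) (show i + 1 ≤ i + 2 by omega)
  rw [segE_succ, segE_succ] at h2
  rw [segE_succ, ← h2] at h1
  simp only [fkH, hz] at h1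
  have := hW0 (x (i + 1))
  nlinarith

/-! ### Segments of least energy in the quasiperiodic potential -/

/-- The rotation number. -/
noncomputable def rot : ℝ := (3 * Real.goldenRatio + 1) / 2

theorem rot_gt : 2.927 ≤ rot := by
  have := goldenRatio_gt; rw [rot]; linarith

theorem rot_lt : rot < 2.928 := by
  have := goldenRatio_lt; rw [rot]; linarith

theorem V_continuous : Continuous V := differentiable_V.continuous

/-- The segments whose limits are the minimal configurations of rotation number `rot`. -/
structure IsRotSeg (n : ℕ) (x : ℕ → ℝ) : Prop where
  large : 20 ≤ n
  isMin : IsMinSeg V n x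
  mono_succ : ∀ i < n, x i ≤ x (i + 1)
  slope : |x n - x 0 - rot * n| ≤ 1

namespace IsRotSeg

variable {n : ℕ} {x : ℕ → ℝ}

theorem mono (hx : IsRotSeg n x) {i j : ℕ} (hij : i ≤ j) (hj : j ≤ n) : x i ≤ x j := by
  induction j, hij using Nat.le_induction with
  | base => exact le_rfl
  | succ j _ ih => exact (ih (by omega)).trans (hx.mono_succ j (by omega))

/-- A zero of `V` lies within `1/3` of the midpoint of the gap, so inserting there gains at least
`gap ^ 2 / 4 - 1 / 9`; removing the middle point of the double step costs at most a quarter of its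
square. If the pieces overlap, the gap lies inside the double step. -/
theorem sq_gap_le (hx : IsRotSeg n x) {i j : ℕ} (hi : i + 2 ≤ n) (hj : j + 1 ≤ n) :
    (x (j + 1) - x j) ^ 2 ≤ (x (i + 2) - x i) ^ 2 + 4 / 9 := by
  have hi1 := hx.mono_succ i (by omega)
  have hi2 := hx.mono_succ (i + 1) (by omega)
  have hj1 := hx.mono_succ j (by omega)
  by_cases hd : i + 2 ≤ j ∨ j + 1 ≤ i
  · obtain ⟨z, hz, hz0⟩ := exists_V_eq_zero_near ((x j + x (j + 1)) / 2)
    have h := hx.isMin.move_le V_nonneg hi hj hd hz0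
    rw [abs_le] at hz
    have h1 : (z - (x j + x (j + 1)) / 2) ^ 2 ≤ 1 / 9 := by nlinarith
    nlinarith [sq_nonneg ((x (i + 1) - x i) - (x (i + 2) - x (i + 1)))]
  · have h1 : j = i ∨ j = i + 1 := by omega
    rcases h1 with rfl | rfl <;> nlinarith

/-- The mean gap exceeds 2.8, so some gap does too, and `sq_gap_le` bounds every double step from
below by it. -/
theorem two_step_ge (hx : IsRotSeg n x) {i : ℕ} (hi : i + 2 ≤ n) : x i + 5 / 2 ≤ x (i + 2) := by
  have hn := hx.large
  obtain ⟨j, hj, hgap⟩ : ∃ j < n, 2.8 ≤ x (j + 1) - x j := by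
    by_contra hc
    push Not at hc
    have h1 : ∑ j ∈ Finset.range n, (x (j + 1) - x j) ≤ ∑ j ∈ Finset.range n, (2.8 : ℝ) :=
      Finset.sum_le_sum fun j hj => (hc j (Finset.mem_range.1 hj)).le
    rw [Finset.sum_range_sub, Finset.sum_const, Finset.card_range, nsmul_eq_mul] at h1
    have h2 := hx.slope
    have h3 := rot_gt
    rw [abs_le] at h2
    have h4 : (20 : ℝ) ≤ n := by exact_mod_cast hn
    nlinarith
  have h := hx.sq_gap_le hi hj
  have h1 := hx.mono (show i ≤ i + 2 by omega) hi
  nlinarith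

/-- Dually, averaging yields a double step of length at most 7, and this controls every gap. -/
theorem step_le (hx : IsRotSeg n x) {j : ℕ} (hj : j + 1 ≤ n) : x (j + 1) ≤ x j + 8 := by
  have hn := hx.large
  obtain ⟨i, hi, hgap⟩ : ∃ i, i + 2 ≤ n ∧ x (i + 2) - x i ≤ 7 := by
    by_contra hc
    push Not at hc
    obtain ⟨m, rfl⟩ : ∃ m, n = m + 1 := ⟨n - 1, by omega⟩
    have h1 : ∑ i ∈ Finset.range m, (7 : ℝ) ≤ ∑ i ∈ Finset.range m, (x (i + 2) - x i) :=
      Finset.sum_le_sum fun i hi => (hc i (by have := Finset.mem_range.1 hi; omega)).le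
    have h2 : ∑ i ∈ Finset.range m, (x (i + 2) - x i) = (x (m + 1) + x m) - (x 1 + x 0) := by
      rw [← Finset.sum_range_sub (fun i => x (i + 1) + x i)]
      exact Finset.sum_congr rfl fun i _ => by ring
    rw [h2, Finset.sum_const, Finset.card_range, nsmul_eq_mul] at h1
    have h3 := hx.slope
    have h4 := rot_lt
    have h5 := hx.mono (Nat.le_succ m) le_rfl
    have h6 := hx.mono (Nat.zero_le 1) (by omega)
    rw [abs_le] at h3
    push_cast at h3
    have h7 : (20 : ℝ) ≤ m + 1 := by exact_mod_cast hn
    nlinarith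
  have h := hx.sq_gap_le hi hj
  have h1 := hx.mono (show i ≤ i + 2 by omega) hi
  nlinarith

theorem eight_steps (hx : IsRotSeg n x) {i : ℕ} (hi : i + 8 ≤ n) : x i + 10 ≤ x (i + 8) := by
  have h1 := hx.two_step_ge (i := i) (by omega)
  have h2 := hx.two_step_ge (i := i + 2) (by omega)
  have h3 := hx.two_step_ge (i := i + 4) (by omega)
  have h4 := hx.two_step_ge (i := i + 6) (by omega)
  simp only [add_assoc] at h1 h2 h3 h4
  norm_num at h1 h2 h3 h4
  linarith

end IsRotSeg

theorem exists_isRotSeg {n : ℕ} (hn : 20 ≤ n) (c : ℝ) :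
    ∃ x : ℕ → ℝ, IsRotSeg n x ∧ |x 0 - c| ≤ 1 / 3 ∧ |x n - (c + rot * n)| ≤ 1 / 3 := by
  obtain ⟨a, ha, ha0⟩ := exists_V_eq_zero_near c
  obtain ⟨b, hb, hb0⟩ := exists_V_eq_zero_near (c + rot * n)
  have ha' := abs_le.1 ha
  have hb' := abs_le.1 hb
  have h1 : (20 : ℝ) ≤ n := by exact_mod_cast hn
  have h2 := rot_gt
  obtain ⟨x, hxa, hxb, hx, hmin⟩ := exists_isMinSeg V_continuous V_nonneg
    (show a ≤ b by nlinarith) ha0 hb0 (show 0 < n by omega)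
  refine ⟨x, ⟨hn, hmin, fun i hi => hmin.le_succ ?_ ?_ hi, ?_⟩, by rwa [hxa], by rwa [hxb]⟩
  · exact fun i _ => hxa ▸ (hx i).1
  · exact fun i _ => hxb ▸ (hx i).2
  · rw [hxa, hxb, abs_le]; constructor <;> linarith

/-! ### Equal patterns carry almost equally many points -/

/-- Two neighbours on one side of a point of equilibrium agree if those on the other side do. -/
theorem eq_of_isLocalMin {W : ℝ → ℝ} {p a a' c : ℝ} (hW : DifferentiableAt ℝ W p)
    (h : IsLocalMin (fun u => 1 / 2 * (a - u) ^ 2 + 1 / 2 * (u - c) ^ 2 + W u) p)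
    (h' : IsLocalMin (fun u => 1 / 2 * (a' - u) ^ 2 + 1 / 2 * (u - c) ^ 2 + W u) p) : a = a' := by
  have key : ∀ d : ℝ, HasDerivAt (fun u => 1 / 2 * (d - u) ^ 2 + 1 / 2 * (u - c) ^ 2 + W u)
      (-(d - p) + (p - c) + deriv W p) p := by
    intro d
    have h1 := (((hasDerivAt_id p).const_sub d).pow 2).const_mul (1 / 2)
    have h2 := (((hasDerivAt_id p).sub_const c).pow 2).const_mul (1 / 2)
    refine ((h1.add h2).add hW.hasDerivAt).congr_deriv ?_
    simp
  have e1 := h.hasDerivAt_eq_zero (key a)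
  have e2 := h'.hasDerivAt_eq_zero (key a')
  linarith

namespace IsRotSeg

variable {n : ℕ} {x : ℕ → ℝ}

/-- Discrete intermediate value argument: the translated stretch, with indices shifted by `κ`,
starts to the right of the other one and, having enough surplus points, ends weakly to its left. -/
theorem exists_crossing (hx : IsRotSeg n x) {T a b : ℝ} {p q N M κ : ℕ} (hκ : 1 ≤ κ)
    (hM : N + 1 + κ ≤ M) (hp : x p < a) (hpN : b ≤ x (p + N + 1))
    (hq : a + T ≤ x (q + 1)) (hqM : x (q + M) ≤ b + T) (hqn : q + M ≤ n) :
    ∃ i ≤ N, (∀ i' ≤ i, x (p + i') < x (q + i' + κ) - T) ∧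
      x (q + i + 1 + κ) - T ≤ x (p + i + 1) := by
  have hex : ∃ i, x (q + i + κ) - T ≤ x (p + i) := by
    refine ⟨N + 1, ?_⟩
    have := hx.mono (show q + (N + 1) + κ ≤ q + M by omega) hqn
    rw [show p + (N + 1) = p + N + 1 by ring]
    linarith
  classical
  obtain ⟨i, hi⟩ : ∃ i, Nat.find hex = i + 1 := by
    refine Nat.exists_eq_succ_of_ne_zero fun h => ?_
    have h1 := Nat.find_spec hex
    rw [h] at h1
    have h2 := hx.mono (show q + 1 ≤ q + 0 + κ by omega) (by omega)
    simp only [add_zero] at h1 h2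
    linarith
  refine ⟨i, ?_, fun i' hi' => not_le.1 (Nat.find_min hex (by omega)), ?_⟩
  · have h1 : Nat.find hex ≤ N + 1 := Nat.find_min' hex (by
      have := hx.mono (show q + (N + 1) + κ ≤ q + M by omega) hqn
      rw [show p + (N + 1) = p + N + 1 by ring]
      linarith)
    omega
  · have h1 := Nat.find_spec hex
    rw [hi] at h1
    exact h1

theorem balance_index (hx : IsRotSeg n x) {T a b : ℝ}
    (hT : ∀ y, a ≤ y → y ≤ b → V (y + T) = V y) {p q N M : ℕ} (hp : x p < a)
    (hpN : b ≤ x (p + N + 1)) (hpn : p + N + 1 ≤ n) (hq : a + T ≤ x (q + 1))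
    (hqM : x (q + M) ≤ b + T) (hqn : q + M ≤ n) (hdisj : p + N + 1 ≤ q + 1 ∨ q + M ≤ p) :
    M ≤ N + 9 := by
  by_contra hc
  push Not at hc
  -- The shift 2, rather than 1, keeps the first crossing strictly inside `(a, b)`, as `hmem` needs.
  -- The shift 9 is the largest that a surplus of 10 allows.
  obtain ⟨i, hiN, hi, hi1⟩ := hx.exists_crossing (show 1 ≤ 2 by omega) (by omega) hp hpN hq hqM hqn
  obtain ⟨j, hjN, hj, hj1⟩ := hx.exists_crossing (show 1 ≤ 9 by omega) (by omega) hp hpN hq hqM hqn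
  -- Otherwise a single step, of length at most 8, would have to outrun eight steps, of total length
  -- at least 10.
  have hij : i + 1 ≤ j := by
    by_contra h
    have h1 := hi j (by omega)
    have h2 := hx.step_le (j := p + j) (by omega)
    have h3 := hx.eight_steps (i := q + j + 2) (by omega)
    rw [show q + j + 2 + 8 = q + j + 1 + 9 by ring] at h3
    linarith
  have hi0 := hi i le_rfl
  have hj0 := hj j le_rfl
  rw [show q + i + 1 + 2 = q + i + 3 by ring] at hi1
  rw [show q + j + 1 + 9 = q + j + 10 by ring] at hj1
  have hg : ∀ t, q + 1 ≤ t → t ≤ q + M → V (x t + -T) = V (x t) := by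
    intro t h1 h2
    have h3 := hx.mono h1 (by omega)
    have h4 := hx.mono h2 hqn
    have h5 := hT (x t + -T) (by linarith) (by linarith)
    rw [← h5]; congr 1; ring
  have hf : ∀ t, p + i + 1 ≤ t → t ≤ p + j → V (x t + T) = V (x t) := by
    intro t h1 h2
    have h3 := hx.mono h1 (by omega)
    have h4 := hx.mono h2 (by omega)
    have h5 := hx.mono (show q + 1 ≤ q + i + 3 by omega) (by omega)
    have h6 := hx.mono (show q + j + 9 ≤ q + M by omega) hqn
    exact hT (x t) (by linarith) (by linarith)
  have q₂ := ((HasPath.single V (x (q + i + 2)) (x (p + i + 1) + T)).append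
    (HasPath.of_seq_add (W := V) (x := x) (show p + i + 1 ≤ p + j by omega) (T := T)
      fun t h1 h2 => hf t h1 h2.le)).append
    (HasPath.single V (x (p + j) + T) (x (q + j + 10)))
  -- The arcs between the crossings trade places, with `u = x (q + i + 3) - T` for the plain swap.
  -- Leaving `u` free records that the swapped path is also optimal in this point.
  have q₁ : ∀ u : ℝ, _ := fun u : ℝ =>
    (((HasPath.single V (x (p + i)) u).append (HasPath.single V u (x (q + i + 4) + -T))).append
    (HasPath.of_seq_add (W := V) (x := x) (show q + i + 4 ≤ q + j + 9 by omega) (T := -T)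
      fun t h1 h2 => hg t (by omega) (by omega))).append
    (HasPath.single V (x (q + j + 9) + -T) (x (p + j + 1)))
  have hex : ∀ u : ℝ, _ := fun u : ℝ => hx.isMin.exchange
    (show p + i ≤ p + j + 1 by omega) (show q + i + 2 ≤ q + j + 10 by omega)
    (by omega) (by omega) (by omega) (q₁ u) q₂ (by omega)
  have a1 := segE_add V x (show p + i ≤ p + i + 1 by omega) (show p + i + 1 ≤ p + j by omega)
  have a2 := segE_add V x (show p + i ≤ p + j by omega) (show p + j ≤ p + j + 1 by omega)
  have b1 := segE_add V x (show q + i + 2 ≤ q + i + 3 by omega) (show q + i + 3 ≤ q + i + 4 by omega)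
  have b2 := segE_add V x (show q + i + 2 ≤ q + i + 4 by omega)
    (show q + i + 4 ≤ q + j + 9 by omega)
  have b3 := segE_add V x (show q + i + 2 ≤ q + j + 9 by omega)
    (show q + j + 9 ≤ q + j + 10 by omega)
  rw [segE_succ] at a1 a2 b3
  rw [segE_succ V x (q + i + 2), segE_succ V x (q + i + 3)] at b1
  have v1 := hg (q + j + 9) (by omega) (by omega)
  have v2 := hf (p + j) (by omega) le_rfl
  have v3 := hg (q + i + 3) (by omega) (by omega)
  rw [← sub_eq_add_neg] at v3
  simp only [fkH] at hex a1 a2 b1 b3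
  rw [v1, v2] at hex
  set P₀ := x (p + i)
  set P₁ := x (p + i + 1)
  set G₀ := x (q + i + 2)
  set G₁ := x (q + i + 3) with hG₁
  set G₂ := x (q + i + 4)
  set F₀ := x (p + j)
  set F₁ := x (p + j + 1)
  set K₀ := x (q + j + 9)
  set K₁ := x (q + j + 10)
  have c1 : (P₀ - (G₀ - T)) * (P₁ - (G₁ - T)) ≤ 0 :=
    mul_nonpos_of_nonpos_of_nonneg (by linarith) (by linarith)
  have c2 : (F₀ - (K₀ - T)) * (F₁ - (K₁ - T)) ≤ 0 :=
    mul_nonpos_of_nonpos_of_nonneg (by linarith) (by linarith)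
  have main : ∀ u : ℝ, 1 / 2 * (P₀ - (G₁ - T)) ^ 2 + 1 / 2 * ((G₁ - T) - (G₂ - T)) ^ 2 + V G₁
      ≤ 1 / 2 * (P₀ - u) ^ 2 + 1 / 2 * (u - (G₂ - T)) ^ 2 + V u
        + (P₀ - (G₀ - T)) * (P₁ - (G₁ - T)) + (F₀ - (K₀ - T)) * (F₁ - (K₁ - T)) := by
    intro u
    have := hex u
    linarith
  -- The plain swap changes the energy by the sum of two nonpositive products, so minimality forces
  -- both to vanish.
  have c3 : (P₀ - (G₀ - T)) * (P₁ - (G₁ - T)) = 0 := by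
    have := main (G₁ - T)
    rw [v3] at this
    linarith
  have hP : G₁ - T = P₁ := by
    rcases mul_eq_zero.1 c3 with h | h <;> linarith
  have ha' := hx.two_step_ge (i := q + 1) (by omega)
  have ha'' := hx.mono (show q + 1 + 2 ≤ q + i + 3 by omega) (by omega)
  have hb' := hx.two_step_ge (i := q + i + 3) (by omega)
  have hb'' := hx.mono (show q + i + 3 + 2 ≤ q + M by omega) (by omega)
  rw [← hG₁] at ha'' hb'
  have hmem : Set.Ioo a b ∈ 𝓝 (G₁ - T) := Ioo_mem_nhds (by linarith) (by linarith)
  have min1 : IsLocalMin (fun u => 1 / 2 * (P₀ - u) ^ 2 + 1 / 2 * (u - (G₂ - T)) ^ 2 + V u)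
      (G₁ - T) := by
    refine Eventually.of_forall fun u => ?_
    have h1 := main u
    simp only [v3]
    linarith
  have min2 : IsLocalMin (fun u => 1 / 2 * (G₀ - T - u) ^ 2 + 1 / 2 * (u - (G₂ - T)) ^ 2 + V u)
      (G₁ - T) := by
    filter_upwards [hmem] with u hu
    have h1 := hx.isMin.replace (show q + i + 2 ≤ q + i + 4 by omega) (by omega)
      (((HasPath.single V G₀ (u + T)).append (HasPath.single V (u + T) G₂)).cast
        (by omega) rfl rfl rfl)
    rw [← b1] at h1
    simp only [fkH, hT u hu.1.le hu.2.le] at h1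
    simp only [v3]
    linarith
  -- Both paths are in equilibrium at the common point with the same right neighbour, so their left
  -- neighbours agree, against the strict inequality `hi0`.
  have := eq_of_isLocalMin (differentiable_V _) min1 min2
  linarith

end IsRotSeg

/-- The first index `i` with `a ≤ x i`. -/
noncomputable def rk (x : ℕ → ℝ) (a : ℝ) : ℕ := sInf {i | a ≤ x i}

theorem lt_of_lt_rk {x : ℕ → ℝ} {a : ℝ} {i : ℕ} (h : i < rk x a) : x i < a := by
  by_contra hc
  have : rk x a ≤ i := Nat.sInf_le (not_lt.1 hc)
  omega

theorem rk_le {x : ℕ → ℝ} {a : ℝ} {i : ℕ} (h : a ≤ x i) : rk x a ≤ i := Nat.sInf_le h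

/-- A witness is required because `rk` takes the default value 0 when no entry reaches `a`. -/
theorem le_rk {x : ℕ → ℝ} {a : ℝ} {i : ℕ} (h : a ≤ x i) : a ≤ x (rk x a) :=
  Nat.sInf_mem (s := {i | a ≤ x i}) ⟨i, h⟩

theorem rk_mono {x : ℕ → ℝ} {a b : ℝ} {i : ℕ} (hab : a ≤ b) (h : b ≤ x i) : rk x a ≤ rk x b :=
  rk_le (hab.trans (le_rk h))

theorem rk_pos {x : ℕ → ℝ} {a : ℝ} {i : ℕ} (h0 : x 0 < a) (h : a ≤ x i) : 0 < rk x a := by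
  by_contra hc
  have := le_rk h
  rw [show rk x a = 0 by omega] at this
  linarith

namespace IsRotSeg

variable {n : ℕ} {x : ℕ → ℝ}

theorem balance_le (hx : IsRotSeg n x) {T a b : ℝ} (hT : ∀ y, a ≤ y → y ≤ b → V (y + T) = V y)
    (hab : a ≤ b) (ha : x 0 < a) (hb : b ≤ x n) (haT : x 0 < a + T) (hbT : b + T ≤ x n)
    (hdisj : b ≤ a + T ∨ b + T ≤ a) :
    (rk x (b + T) : ℤ) - rk x (a + T) ≤ rk x b - rk x a + 9 := by
  have h1 := rk_mono hab hb
  have h2 := rk_mono (show a + T ≤ b + T by linarith) hbT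
  have h3 := rk_pos ha (hab.trans hb)
  have h4 := rk_pos haT (show a + T ≤ x n by linarith)
  have h5 := rk_le hb
  have h6 := rk_le hbT
  have h := hx.balance_index hT (p := rk x a - 1) (q := rk x (a + T) - 1)
    (N := rk x b - rk x a) (M := rk x (b + T) - rk x (a + T))
    (lt_of_lt_rk (by omega))
    (by rw [show rk x a - 1 + (rk x b - rk x a) + 1 = rk x b by omega]; exact le_rk hb)
    (by omega)
    (by rw [show rk x (a + T) - 1 + 1 = rk x (a + T) by omega]
        exact le_rk (show a + T ≤ x n by linarith))
    (lt_of_lt_rk (by omega)).le (by omega) (by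
      rcases hdisj with hd | hd
      · left
        have := rk_mono hd (show a + T ≤ x n by linarith)
        omega
      · right
        have := rk_mono hd (hab.trans hb)
        omega)
  omega

theorem balance (hx : IsRotSeg n x) {T a b : ℝ} (hT : ∀ y, a ≤ y → y ≤ b → V (y + T) = V y)
    (hab : a ≤ b) (ha : x 0 < a) (hb : b ≤ x n) (haT : x 0 < a + T) (hbT : b + T ≤ x n)
    (hdisj : b ≤ a + T ∨ b + T ≤ a) :
    |((rk x (b + T) : ℤ) - rk x (a + T)) - (rk x b - rk x a)| ≤ 9 := by
  have h1 := hx.balance_le hT hab ha hb haT hbT hdisj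
  have h2 := hx.balance_le (T := -T) (a := a + T) (b := b + T) (fun y hy1 hy2 => by
    rw [← hT (y + -T) (by linarith) (by linarith)]; congr 1; ring) (by linarith) haT hbT
    (by linarith) (by linarith) (by rcases hdisj with h | h <;> [right; left] <;> linarith)
  simp only [add_neg_cancel_right] at h2
  rw [abs_le]
  constructor <;> linarith

theorem rk_sub_le (hx : IsRotSeg n x) {a b : ℝ} (hab : b ≤ a + 2) (ha : a ≤ x n) (hb : b ≤ x n) :
    rk x b ≤ rk x a + 2 := by
  have h1 := le_rk ha
  rcases le_or_gt (rk x a + 2) n with h | h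
  · have h2 := hx.two_step_ge h
    exact rk_le (by linarith)
  · have := rk_le hb
    omega

theorem rk_le_add (hx : IsRotSeg n x) {a : ℝ} (ha : x 0 < a) (hb : a ≤ x n) :
    x (rk x a) ≤ a + 8 := by
  have h1 := rk_pos ha hb
  have h2 := rk_le hb
  have h3 := hx.step_le (j := rk x a - 1) (by omega)
  have h4 : x (rk x a - 1) < a := lt_of_lt_rk (by omega)
  rw [show rk x a - 1 + 1 = rk x a by omega] at h3
  linarith

end IsRotSeg

/-! ### Almost periods of the chain -/

/-- A perturbation of size at most `δ` cannot carry a number across an integer farther than `δ`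
away. -/
theorem beatty_add {s m t : ℤ} {δ : ℝ} (hs : |s * Real.goldenRatio - m| ≤ δ)
    (ht : ∀ z : ℤ, δ < |((t : ℝ) + 1) * Real.goldenRatio - z|) :
    beatty (t + s) = beatty t + m := by
  have h1 := Int.le_ceil (((t : ℝ) + 1) * Real.goldenRatio)
  have h2 := Int.ceil_lt_add_one (((t : ℝ) + 1) * Real.goldenRatio)
  have h3 := ht ⌈((t : ℝ) + 1) * Real.goldenRatio⌉
  have h4 := ht (⌈((t : ℝ) + 1) * Real.goldenRatio⌉ - 1)
  push_cast at h4
  rw [abs_of_nonpos (by linarith)] at h3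
  rw [abs_of_nonneg (by linarith)] at h4
  rw [abs_le] at hs
  rw [beatty, beatty, Int.ceil_eq_iff]
  push_cast
  constructor <;> linarith

theorem chain_add {s m t : ℤ} {δ : ℝ} (hs : |s * Real.goldenRatio - m| ≤ δ)
    (ht : ∀ z : ℤ, δ < |((t : ℝ) + 1) * Real.goldenRatio - z|) :
    chain (t + s) = chain t + (s + (Real.goldenRatio - 1) * (m - s)) := by
  rw [chain_eq, chain_eq, beatty_add hs ht]
  push_cast
  ring

/-- The golden ratio is badly approximable. -/
theorem one_le_mul_goldenRatio_sub {j z : ℤ} (hj : j ≠ 0) :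
    1 ≤ |j * Real.goldenRatio - z| * (|j * Real.goldenRatio - z| + 3 * |(j : ℝ)|) := by
  -- The norm of a nonzero element of `ℤ[τ]` is a nonzero integer.
  have h1 : ((j : ℝ) * Real.goldenRatio - z) * (j * Real.goldenConj - z)
      = ((-j ^ 2 - j * z + z ^ 2 : ℤ) : ℝ) := by
    push_cast
    linear_combination (j : ℝ) ^ 2 * Real.goldenRatio_mul_goldenConj
      - (j : ℝ) * z * Real.goldenRatio_add_goldenConj
  have h2 : (j : ℝ) * Real.goldenRatio - z ≠ 0 :=
    sub_ne_zero.2 ((Real.goldenRatio_irrational.intCast_mul hj).ne_int z)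
  have h3 : (j : ℝ) * Real.goldenConj - z ≠ 0 :=
    sub_ne_zero.2 ((Real.goldenConj_irrational.intCast_mul hj).ne_int z)
  have h4 : (-j ^ 2 - j * z + z ^ 2 : ℤ) ≠ 0 := by
    intro h
    rw [h, Int.cast_zero] at h1
    exact mul_ne_zero h2 h3 h1
  have h5 : (1 : ℝ) ≤ |((-j ^ 2 - j * z + z ^ 2 : ℤ) : ℝ)| := by
    exact_mod_cast Int.one_le_abs h4
  rw [← h1, abs_mul] at h5
  refine h5.trans (mul_le_mul_of_nonneg_left ?_ (abs_nonneg _))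
  have h6 : (j : ℝ) * Real.goldenConj - z
      = (j * Real.goldenRatio - z) + (1 - 2 * Real.goldenRatio) * j := by
    rw [← Real.one_sub_goldenConj]; ring
  rw [h6]
  refine (abs_add_le _ _).trans ?_
  rw [abs_mul]
  have h7 : |1 - 2 * Real.goldenRatio| ≤ 3 := by
    have := goldenRatio_gt
    have := goldenRatio_lt
    rw [abs_le]; constructor <;> linarith
  nlinarith [abs_nonneg (j : ℝ)]

/-- Two bad indices would make `(t - t') * τ` closer to an integer than bad approximability permits.
Thus a window of `Λ` tiles meets at most one place where an almost period may fail. -/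
theorem eq_of_both_near {Λ : ℕ} {t t' z z' : ℤ} (hΛ : |t - t'| ≤ Λ)
    (h : |((t : ℝ) + 1) * Real.goldenRatio - z| ≤ 1 / (4 * (1 + 3 * Λ)))
    (h' : |((t' : ℝ) + 1) * Real.goldenRatio - z'| ≤ 1 / (4 * (1 + 3 * Λ))) : t = t' := by
  by_contra hne
  have h1 := one_le_mul_goldenRatio_sub (j := t - t') (z := z - z') (sub_ne_zero.2 hne)
  have h2 : |((t - t' : ℤ) : ℝ) * Real.goldenRatio - ((z - z' : ℤ) : ℝ)|
      ≤ 2 * (1 / (4 * (1 + 3 * Λ))) := by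
    have : ((t - t' : ℤ) : ℝ) * Real.goldenRatio - ((z - z' : ℤ) : ℝ)
      = (((t : ℝ) + 1) * Real.goldenRatio - z) - (((t' : ℝ) + 1) * Real.goldenRatio - z') := by
      push_cast; ring
    rw [this]
    refine (abs_sub _ _).trans ?_
    linarith
  have h3 : |((t - t' : ℤ) : ℝ)| ≤ Λ := by exact_mod_cast hΛ
  set d := |((t - t' : ℤ) : ℝ) * Real.goldenRatio - ((z - z' : ℤ) : ℝ)|
  have hΛ0 : (0 : ℝ) ≤ Λ := Nat.cast_nonneg _
  have h4 : 2 * (1 / (4 * (1 + 3 * (Λ : ℝ)))) * (1 + 3 * Λ) = 1 / 2 := by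
    field_simp
    norm_num
  have h5 : 2 * (1 / (4 * (1 + 3 * (Λ : ℝ)))) ≤ 1 := by
    rw [mul_one_div, div_le_one (by positivity)]; linarith
  have h6 : d * (d + 3 * |((t - t' : ℤ) : ℝ)|) ≤ d * (1 + 3 * Λ) :=
    mul_le_mul_of_nonneg_left (by linarith) (abs_nonneg _)
  have h7 : d * (1 + 3 * (Λ : ℝ)) ≤ 2 * (1 / (4 * (1 + 3 * (Λ : ℝ)))) * (1 + 3 * Λ) :=
    mul_le_mul_of_nonneg_right h2 (by positivity)
  linarith

theorem exists_almost_period {δ : ℝ} (hδ : 0 < δ) :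
    ∃ K : ℕ, ∀ s₀ : ℤ, ∃ s m : ℤ, s₀ ≤ s ∧ s ≤ s₀ + K ∧ |s * Real.goldenRatio - m| ≤ δ := by
  have hψ : |Real.goldenConj| < 1 := by
    rw [abs_lt]; constructor <;> linarith [Real.neg_one_lt_goldenConj, Real.goldenConj_neg]
  -- With an odd Fibonacci index, `q * τ` exceeds an integer by some `η` in `(0, δ]`. Adding `q`
  -- repeatedly to `s₀` moves `s₀ * τ` modulo 1 upwards by `η`, so it comes within `δ` of an integer
  -- after at most `⌈1 / η⌉₊` additions.
  obtain ⟨N, hN⟩ := exists_pow_lt_of_lt_one hδ hψ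
  set η := -Real.goldenConj ^ (2 * N + 1) with hη
  have hη' : η = |Real.goldenConj| ^ (2 * N + 1) := by
    rw [hη, abs_of_neg Real.goldenConj_neg, Odd.neg_pow ⟨N, rfl⟩]
  have hη0 : 0 < η := by
    rw [hη']; exact pow_pos (abs_pos.2 Real.goldenConj_ne_zero) _
  have hηδ : η ≤ δ := by
    rw [hη']
    exact (pow_le_pow_of_le_one (abs_nonneg _) hψ.le (by omega)).trans hN.le
  have hq := Real.fib_succ_sub_goldenRatio_mul_fib (2 * N + 1)
  set q := Nat.fib (2 * N + 1)
  refine ⟨q * ⌈1 / η⌉₊, fun s₀ => ?_⟩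
  set y := (s₀ : ℝ) * Real.goldenRatio with hy
  set r := ⌈((⌈y⌉ : ℝ) - y) / η⌉₊ with hr
  have hr0 : 0 ≤ ((⌈y⌉ : ℝ) - y) / η := div_nonneg (by linarith [Int.le_ceil y]) hη0.le
  have hr1 : ((⌈y⌉ : ℝ) - y) / η ≤ r := Nat.le_ceil _
  have hr2 : (r : ℝ) < ((⌈y⌉ : ℝ) - y) / η + 1 := Nat.ceil_lt_add_one hr0
  have hr3 : r ≤ ⌈1 / η⌉₊ := by
    refine Nat.ceil_mono (div_le_div_of_nonneg_right ?_ hη0.le)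
    linarith [Int.ceil_lt_add_one y]
  rw [div_le_iff₀ hη0] at hr1
  rw [← sub_lt_iff_lt_add, lt_div_iff₀ hη0] at hr2
  refine ⟨s₀ + q * r, ⌈y⌉ + r * Nat.fib (2 * N + 1 + 1), ?_, ?_, ?_⟩
  · have : (0 : ℤ) ≤ (q : ℤ) * r := by positivity
    linarith
  · have : (q : ℤ) * r ≤ q * ⌈1 / η⌉₊ := by
      exact_mod_cast Nat.mul_le_mul_left q hr3
    push_cast
    linarith
  · push_cast
    have : ((s₀ : ℝ) + q * r) * Real.goldenRatio - (⌈y⌉ + r * Nat.fib (2 * N + 1 + 1))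
        = r * η - ((⌈y⌉ : ℝ) - y) := by
      rw [hη, ← hq, hy]; ring
    rw [this, abs_le]
    constructor <;> linarith

/-! ### Uniform distribution of the points of a segment over the tiles -/

/-- The first index of a point to the right of the `k`-th chain point. -/
noncomputable def rkC (x : ℕ → ℝ) (k : ℤ) : ℝ := rk x (chain k)

namespace IsRotSeg

variable {n : ℕ} {x : ℕ → ℝ}

theorem rkC_mono {k l : ℤ} (hkl : k ≤ l) (hl : chain l ≤ x n) : rkC x k ≤ rkC x l :=
  Nat.cast_le.2 (rk_mono (chain_strictMono.monotone hkl) hl)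

theorem rkC_le (hx : IsRotSeg n x) {k l : ℤ} (hkl : k ≤ l) (hl : chain l ≤ x n) :
    rkC x l ≤ rkC x k + 2 * (l - k) := by
  induction l, hkl using Int.leInduction with
  | base => simp
  | succ l hkl ih =>
    have h1 := (chain_strictMono.monotone (show l ≤ l + 1 by omega)).trans hl
    have h2 := chain_succ_le l
    have h3 := goldenRatio_lt
    have h4 := hx.rk_sub_le (show chain (l + 1) ≤ chain l + 2 by linarith) h1 hl
    have h5 : rkC x (l + 1) ≤ rkC x l + 2 := by
      rw [rkC, rkC]; exact_mod_cast h4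
    have := ih h1
    push_cast
    linarith

theorem rkC_repeat (hx : IsRotSeg n x) {s m k l : ℤ} {δ : ℝ}
    (hs : |s * Real.goldenRatio - m| ≤ δ) (hkl : k ≤ l) (hls : l ≤ k + s)
    (ht : ∀ t : ℤ, k ≤ t → t ≤ l → ∀ z : ℤ, δ < |((t : ℝ) + 1) * Real.goldenRatio - z|)
    (h0 : x 0 < chain k) (hn : chain (l + s) ≤ x n) :
    |(rkC x (l + s) - rkC x (k + s)) - (rkC x l - rkC x k)| ≤ 9 := by
  set T : ℝ := s + (Real.goldenRatio - 1) * (m - s) with hTdef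
  have hT : ∀ t, k ≤ t → t ≤ l → chain (t + s) = chain t + T :=
    fun t h1 h2 => chain_add hs (ht t h1 h2)
  have hk := hT k le_rfl hkl
  have hl := hT l hkl le_rfl
  have h1 : chain k ≤ chain l := chain_strictMono.monotone hkl
  have h2 : chain l ≤ chain (k + s) := chain_strictMono.monotone hls
  have h3 : chain (k + s) ≤ chain (l + s) := chain_strictMono.monotone (by omega)
  have h := hx.balance (T := T) (a := chain k) (b := chain l)
    (fun y hy1 hy2 => V_add_eq hT hy1 hy2) h1 h0 (by linarith) (by linarith) (by linarith)
    (Or.inl (by linarith))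
  rw [← hk, ← hl] at h
  simp only [rkC]
  exact_mod_cast h

theorem rkC_step (hx : IsRotSeg n x) {k s : ℤ} (hs : 0 ≤ s) (hn : chain (k + 1 + s) ≤ x n) :
    |(rkC x (k + 1 + s) - rkC x (k + s)) - (rkC x (k + 1) - rkC x k)| ≤ 2 := by
  have h1 := (chain_strictMono.monotone (show k + 1 ≤ k + 1 + s by omega)).trans hn
  have a1 := rkC_mono (x := x) (show k + s ≤ k + 1 + s by omega) hn
  have a2 := hx.rkC_le (show k + s ≤ k + 1 + s by omega) hn
  have b1 := rkC_mono (x := x) (show k ≤ k + 1 by omega) h1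
  have b2 := hx.rkC_le (show k ≤ k + 1 by omega) h1
  push_cast at a2 b2
  rw [abs_le]
  constructor <;> linarith

/-- Cut the window at its bad index, if there is one. Each side contributes 9 from balance and 2
from the tile next to the cut. -/
theorem rkC_window (hx : IsRotSeg n x) {Λ : ℕ} {s m k : ℤ}
    (hs : |s * Real.goldenRatio - m| ≤ 1 / (4 * (1 + 3 * Λ))) (hΛ : (Λ : ℤ) ≤ s)
    (h0 : x 0 < chain k) (hn : chain (k + Λ + s) ≤ x n) :
    |(rkC x (k + Λ + s) - rkC x (k + s)) - (rkC x (k + Λ) - rkC x k)| ≤ 22 := by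
  by_cases hbad : ∃ t : ℤ, k ≤ t ∧ t ≤ k + Λ ∧
      ∃ z : ℤ, |((t : ℝ) + 1) * Real.goldenRatio - z| ≤ 1 / (4 * (1 + 3 * Λ))
  · obtain ⟨t, ht1, ht2, z, hz⟩ := hbad
    have hgood : ∀ t' : ℤ, k ≤ t' → t' ≤ k + Λ → t' ≠ t → ∀ z' : ℤ,
        1 / (4 * (1 + 3 * (Λ : ℝ))) < |((t' : ℝ) + 1) * Real.goldenRatio - z'| := by
      intro t' h1 h2 hne z'
      by_contra hc
      exact hne (eq_of_both_near (abs_le.2 ⟨by omega, by omega⟩) (not_lt.1 hc) hz)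
    have hmono : ∀ {i : ℤ}, i ≤ k + Λ → chain (i + s) ≤ x n := fun hi =>
      (chain_strictMono.monotone (by omega)).trans hn
    have left : |(rkC x (t + s) - rkC x (k + s)) - (rkC x t - rkC x k)| ≤ 11 := by
      rcases eq_or_lt_of_le ht1 with rfl | h
      · simp
      · have h1 := hx.rkC_repeat hs (show k ≤ t - 1 by omega) (by omega)
          (fun t' a b => hgood t' a (by omega) (by omega)) h0 (hmono (by omega))
        have h2 := hx.rkC_step (k := t - 1) (s := s) (by omega)
          (by rw [sub_add_cancel]; exact hmono ht2)
        rw [sub_add_cancel] at h2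
        rw [abs_le] at h1 h2 ⊢
        constructor <;> linarith [h1.1, h1.2, h2.1, h2.2]
    have right : |(rkC x (k + Λ + s) - rkC x (t + s)) - (rkC x (k + Λ) - rkC x t)| ≤ 11 := by
      rcases eq_or_lt_of_le ht2 with rfl | h
      · simp
      · have h3 : x 0 < chain (t + 1) := h0.trans_le (chain_strictMono.monotone (by omega))
        have h1 := hx.rkC_repeat hs (show t + 1 ≤ k + Λ by omega) (by omega)
          (fun t' a b => hgood t' (by omega) b (by omega)) h3 hn
        have h2 := hx.rkC_step (k := t) (s := s) (by omega) (hmono (by omega))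
        rw [abs_le] at h1 h2 ⊢
        constructor <;> linarith [h1.1, h1.2, h2.1, h2.2]
    rw [abs_le] at left right ⊢
    constructor <;> linarith [left.1, left.2, right.1, right.2]
  · push Not at hbad
    exact (hx.rkC_repeat hs (by omega) (by omega) hbad h0 hn).trans (by norm_num)

theorem rkC_windows (hx : IsRotSeg n x) {Λ : ℕ} {s m k : ℤ} (h : ℕ)
    (hs : |s * Real.goldenRatio - m| ≤ 1 / (4 * (1 + 3 * Λ))) (hΛ : (Λ : ℤ) ≤ s)
    (h0 : x 0 < chain k) (hn : chain (k + (h * Λ : ℕ) + s) ≤ x n) :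
    |(rkC x (k + (h * Λ : ℕ) + s) - rkC x (k + s)) - (rkC x (k + (h * Λ : ℕ)) - rkC x k)|
      ≤ 22 * h := by
  induction h with
  | zero => simp
  | succ h ih =>
    have e : k + (((h + 1) * Λ : ℕ) : ℤ) = k + (h * Λ : ℕ) + Λ := by push_cast; ring
    rw [e] at hn ⊢
    have h1 := hx.rkC_window (k := k + (h * Λ : ℕ)) hs hΛ
      (h0.trans_le (chain_strictMono.monotone (by omega))) hn
    have h2 := ih ((chain_strictMono.monotone (by omega)).trans hn)
    rw [abs_le] at h1 h2 ⊢
    rw [Nat.cast_add_one]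
    constructor <;> linarith [h1.1, h1.2, h2.1, h2.2]

theorem rkC_slide (hx : IsRotSeg n x) {k l : ℤ} (L : ℕ) (hkl : k ≤ l) (hn : chain (l + L) ≤ x n) :
    |(rkC x (l + L) - rkC x l) - (rkC x (k + L) - rkC x k)| ≤ 2 * (l - k) := by
  have h1 := (chain_strictMono.monotone (show l ≤ l + L by omega)).trans hn
  have a1 := rkC_mono (x := x) (show k + L ≤ l + L by omega) hn
  have a2 := hx.rkC_le (show k + L ≤ l + L by omega) hn
  have b1 := rkC_mono (x := x) hkl h1
  have b2 := hx.rkC_le hkl h1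
  push_cast at a2 b2
  rw [abs_le]
  constructor <;> linarith

end IsRotSeg

theorem exists_window_length {ε : ℝ} (hε : 0 < ε) : ∃ L K : ℕ, 0 < L ∧
    ∀ (n : ℕ) (x : ℕ → ℝ), IsRotSeg n x → ∀ k l : ℤ, k ≤ l → x 0 < chain k →
      chain (l + L + K) ≤ x n →
      -- With `L = h * Λ`, the `h` windows cost `22 * h`, less than half of `ε * L` since `44 < ε *
      -- Λ`; `h` is then so large that `2 * K + 2 * Λ` fits into the other half.
      |(rkC x (l + L) - rkC x l) - (rkC x (k + L) - rkC x k)| ≤ ε * L := by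
  obtain ⟨Λ, hΛ⟩ := exists_nat_gt (44 / ε)
  have hΛ0 : (0 : ℝ) < Λ := lt_trans (by positivity) hΛ
  obtain ⟨K, hK⟩ := exists_almost_period (δ := 1 / (4 * (1 + 3 * (Λ : ℝ)))) (by positivity)
  obtain ⟨h, hh⟩ := exists_nat_gt ((2 * K + 2 * Λ) / 22 : ℝ)
  have hh0 : (0 : ℝ) < h := lt_of_le_of_lt (by positivity) hh
  have hΛε : 44 < ε * Λ := by rw [div_lt_iff₀ hε] at hΛ; linarith
  have hL : 22 * (h : ℝ) + 2 * K + 2 * Λ ≤ ε * (h * Λ : ℕ) := by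
    push_cast
    nlinarith
  refine ⟨h * Λ, K, ?_, ?_⟩
  · exact Nat.mul_pos (by exact_mod_cast hh0) (by exact_mod_cast hΛ0)
  intro n x hx k l hkl h0 hn
  have hn' : chain (l + (h * Λ : ℕ)) ≤ x n := (chain_strictMono.monotone (by omega)).trans hn
  have hK0 : (0 : ℝ) ≤ K := Nat.cast_nonneg _
  refine le_trans ?_ hL
  rcases lt_or_ge (l - k) Λ with hd | hd
  · refine (hx.rkC_slide _ hkl hn').trans ?_
    have : (l : ℝ) - k ≤ Λ := by exact_mod_cast hd.le
    linarith
  -- The shift `l - k` need not be an almost period: overshoot to the next one and slide back by at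
  -- most `K` tiles.
  · obtain ⟨s, m, hs1, hs2, hs⟩ := hK (l - k)
    have hn2 : chain (k + (h * Λ : ℕ) + s) ≤ x n :=
      (chain_strictMono.monotone (by omega)).trans hn
    have h1 := hx.rkC_windows h hs (by omega) h0 hn2
    have h2 := hx.rkC_slide (h * Λ) (show l ≤ k + s by omega)
      (by rwa [show k + s + ((h * Λ : ℕ) : ℤ) = k + (h * Λ : ℕ) + s by ring])
    rw [show k + s + ((h * Λ : ℕ) : ℤ) = k + (h * Λ : ℕ) + s by ring] at h2
    have h3 : ((k + s : ℤ) : ℝ) - l ≤ K := by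
      have : k + s - l ≤ K := by omega
      exact_mod_cast this
    rw [abs_le] at h1 h2 ⊢
    constructor <;> linarith [h1.1, h1.2, h2.1, h2.2]

theorem meanLen_bounds : 1 ≤ meanLen ∧ meanLen ≤ 1.4 := by
  have h1 := goldenRatio_gt
  have h2 := goldenRatio_lt
  rw [meanLen]
  constructor <;> nlinarith

namespace IsRotSeg

variable {n : ℕ} {x : ℕ → ℝ}

theorem le_add_steps (hx : IsRotSeg n x) {i j : ℕ} (hij : i ≤ j) (hj : j ≤ n) :
    x j ≤ x i + 8 * ((j : ℝ) - i) := by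
  induction j, hij using Nat.le_induction with
  | base => simp
  | succ j _ ih =>
    have h1 := ih (by omega)
    have h2 := hx.step_le hj
    push_cast
    linarith

theorem rkC_blocks {L K : ℕ} {ε : ℝ}
    (hLK : ∀ k l : ℤ, k ≤ l → x 0 < chain k → chain (l + L + K) ≤ x n →
      |(rkC x (l + L) - rkC x l) - (rkC x (k + L) - rkC x k)| ≤ ε * L)
    {k₀ k : ℤ} (h0 : x 0 < chain k₀) (hk : k₀ ≤ k) (m : ℕ)
    (hm : chain (k + (m * L : ℕ) + K) ≤ x n) :
    |(rkC x (k + (m * L : ℕ)) - rkC x k) - m * (rkC x (k₀ + L) - rkC x k₀)| ≤ m * (ε * L) := by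
  induction m with
  | zero => simp
  | succ m ih =>
    have e : k + (((m + 1) * L : ℕ) : ℤ) = k + (m * L : ℕ) + L := by push_cast; ring
    rw [e] at hm ⊢
    have h1 := hLK k₀ (k + (m * L : ℕ)) (by omega) h0 hm
    have h2 := ih ((chain_strictMono.monotone (by omega)).trans hm)
    rw [abs_le] at h1 h2 ⊢
    rw [Nat.cast_add_one]
    constructor <;> linarith [h1.1, h1.2, h2.1, h2.2]

/-- All blocks of `L` tiles hold nearly as many points as the first, so `b` is its density; the
incomplete block costs `2 * L`. If not even one block fits, `b = 0` will do. -/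
theorem rkC_linear (hx : IsRotSeg n x) {L K : ℕ} {ε : ℝ} (hε : 0 ≤ ε) (hL : 0 < L)
    (hLK : ∀ k l : ℤ, k ≤ l → x 0 < chain k → chain (l + L + K) ≤ x n →
      |(rkC x (l + L) - rkC x l) - (rkC x (k + L) - rkC x k)| ≤ ε * L)
    {k₀ : ℤ} (h0 : x 0 < chain k₀) : ∃ b : ℝ, ∀ k l : ℤ, k₀ ≤ k → k ≤ l → chain (l + K) ≤ x n →
      |rkC x l - rkC x k - b * (l - k)| ≤ ε * (l - k) + 2 * L := by
  by_cases hlast : chain (k₀ + L) ≤ x n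
  swap
  · refine ⟨0, fun k l hk hkl hl => ?_⟩
    have hl' : chain l ≤ x n := (chain_strictMono.monotone (by omega)).trans hl
    have h1 := rkC_mono (x := x) hkl hl'
    have h2 := hx.rkC_le hkl hl'
    have h3 : l < k₀ + L := chain_strictMono.lt_iff_lt.1 (by linarith)
    have h4 : (l : ℝ) - k ≤ L := by
      have : l - k ≤ L := by omega
      exact_mod_cast this
    have h5 : (0 : ℝ) ≤ (l : ℝ) - k := sub_nonneg.2 (by exact_mod_cast hkl)
    have h6 := mul_nonneg hε h5
    rw [abs_le]
    constructor <;> linarith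
  have hLpos : (0 : ℝ) < L := by exact_mod_cast hL
  refine ⟨(rkC x (k₀ + L) - rkC x k₀) / L, fun k l hk hkl hl => ?_⟩
  have a1 := rkC_mono (x := x) (show k₀ ≤ k₀ + L by omega) hlast
  have a2 := hx.rkC_le (show k₀ ≤ k₀ + L by omega) hlast
  set β := rkC x (k₀ + L) - rkC x k₀ with hβ
  have hb0 : 0 ≤ β / L := div_nonneg (by linarith) hLpos.le
  have hb2 : β / L ≤ 2 := by
    rw [div_le_iff₀ hLpos]; push_cast at a2; linarith
  have hbL : β = β / L * L := by field_simp
  set b := β / L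
  obtain ⟨d, rfl⟩ : ∃ d : ℕ, l = k + d := ⟨(l - k).toNat, by omega⟩
  have hd := Nat.div_add_mod d L
  have hr := Nat.mod_lt d hL
  set m := d / L
  set r := d % L
  rw [mul_comm] at hd
  have hl' : chain (k + d) ≤ x n := (chain_strictMono.monotone (by omega)).trans hl
  have h1 := rkC_blocks hLK h0 hk m ((chain_strictMono.monotone (by omega)).trans hl)
  have h2 := rkC_mono (x := x) (show k + (m * L : ℕ) ≤ k + d by omega) hl'
  have h3 := hx.rkC_le (show k + (m * L : ℕ) ≤ k + d by omega) hl'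
  rw [← hβ, hbL] at h1
  have hd' : (d : ℝ) = m * L + r := by exact_mod_cast hd.symm
  have hr' : (r : ℝ) ≤ L := by exact_mod_cast hr.le
  have hr0 : (0 : ℝ) ≤ r := Nat.cast_nonneg _
  have h3' : ((k + d : ℤ) : ℝ) - ((k + (m * L : ℕ) : ℤ) : ℝ) = r := by push_cast; linarith
  have h4 : (((k + d : ℤ)) : ℝ) - k = m * L + r := by push_cast; linarith
  have h5 : b * r ≤ 2 * r := mul_le_mul_of_nonneg_right hb2 hr0
  have h6 : 0 ≤ b * r := mul_nonneg hb0 hr0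
  have h7 : 0 ≤ ε * r := mul_nonneg hε hr0
  have h8 : rkC x (k + d) ≤ rkC x (k + (m * L : ℕ)) + 2 * r := by linarith
  rw [h4]
  rw [abs_le] at h1 ⊢
  constructor <;> nlinarith [h1.1, h1.2]

theorem eq_rkC_add (hx : IsRotSeg n x) {i : ℕ} {k : ℤ} (hi : i ≤ n) (h1 : chain k ≤ x i)
    (h2 : x i < chain (k + 1)) (hk : chain (k + 1) ≤ x n) : rkC x k ≤ i ∧ (i : ℝ) ≤ rkC x k + 1 := by
  have h3 := hx.mono hi le_rfl
  have h4 : i < rk x (chain (k + 1)) := by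
    by_contra hc
    have h5 := hx.mono (not_lt.1 hc) hi
    have h6 := le_rk hk
    linarith
  have h5 := chain_succ_le k
  have h6 := goldenRatio_lt
  have h7 := hx.rk_sub_le (show chain (k + 1) ≤ chain k + 2 by linarith) (by linarith) hk
  refine ⟨Nat.cast_le.2 (rk_le h1), ?_⟩
  have h8 : i ≤ rk x (chain k) + 1 := by omega
  rw [rkC]
  exact_mod_cast h8

end IsRotSeg

/-- The density `b` is determined by the whole segment: about `n` points lie on about `rot * n /
meanLen` tiles, up to bounded losses at the ends. Hence `rot * b` is within `4 * ε` of `meanLen`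
once `n` is large. -/
theorem exists_rkC_slope {ε : ℝ} (hε : 0 < ε) : ∃ L K n₀ : ℕ,
    ∀ (n : ℕ) (x : ℕ → ℝ), n₀ ≤ n → IsRotSeg n x → ∀ k l : ℤ, x 0 < chain k → k ≤ l →
      chain (l + K) ≤ x n →
      |rot * (rkC x l - rkC x k) - meanLen * ((l : ℝ) - k)| ≤ 7 * ε * ((l : ℝ) - k) + 6 * L := by
  obtain ⟨L, K, hL, hLK⟩ := exists_window_length hε
  obtain ⟨n₀, hn₀⟩ := exists_nat_gt ((6 * L + 16 + 8 * K) / ε + 7 + 2 * K : ℝ)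
  have hK0 : (0 : ℝ) ≤ K := Nat.cast_nonneg _
  have hL0 : (0 : ℝ) ≤ L := Nat.cast_nonneg _
  refine ⟨L, K, n₀, fun n x hn hx k l hk hkl hlK => ?_⟩
  have hτ := goldenRatio_lt
  obtain ⟨hml, hmu⟩ := meanLen_bounds
  have hθ1 := rot_gt
  have hθ2 := rot_lt
  obtain ⟨k₀', hk0a, hk0b⟩ := exists_chain_le (x 0)
  obtain ⟨k₀, rfl⟩ : ∃ k₀ : ℤ, k₀' = k₀ - 1 := ⟨k₀' + 1, by ring⟩
  have hk0c := chain_succ_le (k₀ - 1)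
  rw [sub_add_cancel] at hk0b hk0c
  obtain ⟨k₁, hk1a, hk1b⟩ := exists_chain_le (x n)
  have hk1c := chain_succ_le k₁
  obtain ⟨b, hb⟩ := hx.rkC_linear hε.le hL (hLK n x hx) hk0b
  have ap : ∀ k : ℤ, -1 ≤ chain k - meanLen * k ∧ chain k - meanLen * k ≤ 1 := fun k =>
    abs_le.1 (abs_chain_sub_le k)
  have ap0 := ap k₀
  have ap1 := ap k₁
  have hslope := abs_le.1 hx.slope
  have hn' : (n₀ : ℝ) ≤ n := by exact_mod_cast hn
  have hn20 : (20 : ℝ) ≤ n := by exact_mod_cast hx.large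
  set D : ℝ := ((k₁ - K : ℤ) : ℝ) - k₀ with hD
  have hDk : (k₁ : ℝ) - k₀ = D + K := by rw [hD]; push_cast; ring
  have hmD : |rot * n - meanLen * D| ≤ 7 + 1.4 * K := by
    have h1 : meanLen * D = meanLen * k₁ - meanLen * k₀ - meanLen * K := by
      linear_combination meanLen * (-hDk)
    have h2 : meanLen * K ≤ 1.4 * K := mul_le_mul_of_nonneg_right hmu hK0
    have h3 : 0 ≤ meanLen * K := by positivity
    rw [h1, abs_le]
    constructor <;> linarith [ap0.1, ap0.2, ap1.1, ap1.2, hslope.1, hslope.2]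
  rw [abs_le] at hmD
  have hDn : (n : ℝ) - 7 - 2 * K ≤ D := by
    by_contra hc
    push Not at hc
    have h1 : meanLen * D ≤ meanLen * (n - 7 - 2 * K) :=
      mul_le_mul_of_nonneg_left hc.le (by linarith)
    have h2 : (0 : ℝ) ≤ n - 7 - 2 * K := by
      have : (0 : ℝ) ≤ (6 * L + 16 + 8 * K) / ε := by positivity
      linarith
    nlinarith [hmD.2]
  have hDbig : 6 * L + 16 + 8 * K ≤ ε * D := by
    have h1 : (6 * L + 16 + 8 * K) / ε ≤ D := by linarith
    rw [div_le_iff₀ hε] at h1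
    linarith
  have hD0 : 0 < D := by
    by_contra hc
    have := mul_nonpos_of_nonneg_of_nonpos hε.le (not_lt.1 hc)
    linarith
  have hk₀₁ : k₀ ≤ k₁ - K := by
    have : (k₀ : ℝ) ≤ ((k₁ - K : ℤ) : ℝ) := by linarith
    exact_mod_cast this
  have hl1 : chain (k₁ - K) ≤ x n := (chain_strictMono.monotone (by omega)).trans hk1a
  have hR : |(n : ℝ) - (rkC x (k₁ - K) - rkC x k₀)| ≤ 2 * K + 3 := by
    have h1 : rkC x k₀ ≤ 2 := by
      have h2 := hx.rk_sub_le (a := x 0) (b := chain k₀) (by linarith)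
        (hx.mono (Nat.zero_le n) le_rfl) ((chain_strictMono.monotone (by omega)).trans hk1a)
      have h3 : rk x (x 0) ≤ 0 := rk_le le_rfl
      have h4 : rk x (chain k₀) ≤ 2 := by omega
      rw [rkC]; exact_mod_cast h4
    have h1' : 0 ≤ rkC x k₀ := Nat.cast_nonneg _
    have h2 : (n : ℝ) ≤ rkC x k₁ + 1 := by
      have h3 : n ≤ rk x (chain k₁) + 1 := by
        by_contra hc
        have h4 := hx.two_step_ge (i := rk x (chain k₁)) (by omega)
        have h5 := hx.mono (show rk x (chain k₁) + 2 ≤ n by omega) le_rfl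
        have h6 := le_rk hk1a
        linarith
      rw [rkC]; exact_mod_cast h3
    have h3 := hx.rkC_le (show k₁ - K ≤ k₁ by omega) hk1a
    have h4 : rkC x (k₁ - K) ≤ n := Nat.cast_le.2 (rk_le hl1)
    push_cast at h3
    rw [abs_le]
    constructor <;> linarith
  rw [abs_le] at hR
  have hbD := abs_le.1 (hb k₀ (k₁ - K) le_rfl hk₀₁ (by rwa [sub_add_cancel]))
  rw [← hD] at hbD
  set Q := rkC x (k₁ - K) - rkC x k₀
  have hb' : |rot * b - meanLen| ≤ 4 * ε := by
    have e1 : rot * (b * D) ≤ rot * (Q + ε * D + 2 * L) :=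
      mul_le_mul_of_nonneg_left (by linarith [hbD.1]) (by linarith)
    have e2 : rot * (Q - ε * D - 2 * L) ≤ rot * (b * D) :=
      mul_le_mul_of_nonneg_left (by linarith [hbD.2]) (by linarith)
    have e3 : rot * Q ≤ rot * (n + (2 * K + 3)) :=
      mul_le_mul_of_nonneg_left (by linarith [hR.1]) (by linarith)
    have e4 : rot * (n - (2 * K + 3)) ≤ rot * Q :=
      mul_le_mul_of_nonneg_left (by linarith [hR.2]) (by linarith)
    have e5 : rot * (2 * K + 3) ≤ 3 * (2 * K + 3) :=
      mul_le_mul_of_nonneg_right (by linarith) (by linarith)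
    have e6 : rot * (ε * D + 2 * L) ≤ 3 * (ε * D + 2 * L) :=
      mul_le_mul_of_nonneg_right (by linarith) (by positivity)
    have e7 : |rot * b - meanLen| * D ≤ 4 * ε * D := by
      rw [← abs_of_pos hD0, ← abs_mul, abs_of_pos hD0, abs_le]
      constructor <;> linarith [hmD.1, hmD.2]
    exact le_of_mul_le_mul_right e7 hD0
  rw [abs_le] at hb'
  have hk₀k : k₀ ≤ k := by
    have : k₀ - 1 < k := chain_strictMono.lt_iff_lt.1 (by linarith)
    omega
  have hbkl := abs_le.1 (hb k l hk₀k hkl hlK)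
  have hlk0 : (0 : ℝ) ≤ (l : ℝ) - k := sub_nonneg.2 (by exact_mod_cast hkl)
  set d : ℝ := (l : ℝ) - k with hd
  set P := rkC x l - rkC x k
  have f1 : rot * (b * d - ε * d - 2 * L) ≤ rot * P :=
    mul_le_mul_of_nonneg_left (by linarith [hbkl.1]) (by linarith)
  have f2 : rot * P ≤ rot * (b * d + ε * d + 2 * L) :=
    mul_le_mul_of_nonneg_left (by linarith [hbkl.2]) (by linarith)
  have f3 : rot * (ε * d + 2 * L) ≤ 3 * (ε * d + 2 * L) :=
    mul_le_mul_of_nonneg_right (by linarith) (by positivity)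
  have f4 : (rot * b - meanLen) * d ≤ 4 * ε * d := mul_le_mul_of_nonneg_right hb'.2 hlk0
  have f5 : -(4 * ε) * d ≤ (rot * b - meanLen) * d := mul_le_mul_of_nonneg_right hb'.1 hlk0
  rw [abs_le]
  constructor <;> linarith

/-- The points of the segments follow an arithmetic progression, uniformly in the length of the
segment. -/
theorem exists_uniform_bound {ε : ℝ} (hε : 0 < ε) : ∃ (C : ℝ) (n₀ : ℕ),
    ∀ (n : ℕ) (x : ℕ → ℝ), n₀ ≤ n → IsRotSeg n x → ∀ i j : ℕ, i ≤ j → j ≤ n → x 0 + 2 ≤ x i →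
      x j + C ≤ x n → |x j - x i - rot * ((j : ℝ) - i)| ≤ ε * ((j : ℝ) - i) + C := by
  -- `56 = 7 * 8`: the slope error is `7` per tile, and a step covers at most 8 tiles up to a
  -- constant.
  obtain ⟨L, K, n₀, hLK⟩ := exists_rkC_slope (show 0 < ε / 56 by positivity)
  have hK0 : (0 : ℝ) ≤ K := Nat.cast_nonneg _
  have hL0 : (0 : ℝ) ≤ L := Nat.cast_nonneg _
  refine ⟨ε + 6 * L + 7 + 2 * K + 10, n₀, fun n x hn hx i j hij hj hi hjn => ?_⟩
  have hτ := goldenRatio_lt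
  obtain ⟨hml, hmu⟩ := meanLen_bounds
  have hθ1 := rot_gt
  have hθ2 := rot_lt
  obtain ⟨k₁, hk1a, hk1b⟩ := exists_chain_le (x n)
  have hk1c := chain_succ_le k₁
  have ap : ∀ k : ℤ, -1 ≤ chain k - meanLen * k ∧ chain k - meanLen * k ≤ 1 := fun k =>
    abs_le.1 (abs_chain_sub_le k)
  have ap1 := ap k₁
  obtain ⟨k, hka, hkb⟩ := exists_chain_le (x i)
  obtain ⟨l, hla, hlb⟩ := exists_chain_le (x j)
  have hkc := chain_succ_le k
  have hlc := chain_succ_le l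
  have hxij := hx.mono hij hj
  have hkl : k ≤ l := by
    have : k < l + 1 := chain_strictMono.lt_iff_lt.1 (by linarith)
    omega
  have hll1 : l + K ≤ k₁ := by
    by_contra hc
    have h1 : ((k₁ - K : ℤ) : ℝ) ≤ l := by
      have : k₁ - K ≤ l := by omega
      exact_mod_cast this
    push_cast at h1
    have h2 : meanLen * (k₁ - K) ≤ meanLen * l := mul_le_mul_of_nonneg_left h1 (by linarith)
    have h3 : meanLen * K ≤ 1.4 * K := mul_le_mul_of_nonneg_right hmu hK0
    linarith [(ap l).1, ap1.2]
  have hlK : chain (l + K) ≤ x n := (chain_strictMono.monotone hll1).trans hk1a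
  have hi' := hx.eq_rkC_add (hij.trans hj) hka hkb (by linarith)
  have hj' := hx.eq_rkC_add hj hla hlb (by linarith)
  have hP := abs_le.1 (hLK n x hn hx k l (by linarith) hkl hlK)
  have hsub := chain_sub_ge hkl
  have hsteps := hx.le_add_steps hij hj
  have hij' : (0 : ℝ) ≤ (j : ℝ) - i := sub_nonneg.2 (by exact_mod_cast hij)
  set d : ℝ := (l : ℝ) - k with hd
  set P := rkC x l - rkC x k
  have hd8 : d ≤ 8 * ((j : ℝ) - i) + 2 := by linarith
  have f6 : rot * ((j : ℝ) - i) ≤ rot * (P + 1) :=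
    mul_le_mul_of_nonneg_left (by linarith [hi'.1, hj'.2]) (by linarith)
  have f7 : rot * (P - 1) ≤ rot * ((j : ℝ) - i) :=
    mul_le_mul_of_nonneg_left (by linarith [hi'.2, hj'.1]) (by linarith)
  have f8 : 7 * (ε / 56) * d ≤ 7 * (ε / 56) * (8 * ((j : ℝ) - i) + 2) :=
    mul_le_mul_of_nonneg_left hd8 (by positivity)
  have f9 : 7 * (ε / 56) * (8 * ((j : ℝ) - i) + 2) = ε * ((j : ℝ) - i) + ε / 4 := by ring
  have apk := ap k
  have apl := ap l
  have f11 : meanLen * d = meanLen * l - meanLen * k := by rw [hd]; ring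
  rw [abs_le]
  constructor <;> linarith [apk.1, apk.2, apl.1, apl.2, hP.1, hP.2]

/-! ### Passing to two-sided configurations -/

theorem segmentEnergy_eq_sum_range (H : ℝ → ℝ → ℝ) (y : ℤ → ℝ) (j k : ℤ) :
    segmentEnergy H y j k
      = ∑ t ∈ Finset.range (k - j).toNat, H (y (j + t)) (y (j + (t + 1 : ℕ))) := by
  refine Finset.sum_nbij' (fun i => (i - j).toNat) (fun t => j + t) ?_ ?_ ?_ ?_ ?_
  · intro i hi
    simp only [Finset.mem_Ico, Finset.mem_range] at hi ⊢
    omega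
  · intro t ht
    simp only [Finset.mem_Ico, Finset.mem_range] at ht ⊢
    omega
  · intro i hi
    simp only [Finset.mem_Ico] at hi
    omega
  · intro t _
    simp
  · intro i hi
    simp only [Finset.mem_Ico] at hi
    rw [show j + ((i - j).toNat : ℤ) = i by omega,
      show j + (((i - j).toNat + 1 : ℕ) : ℤ) = i + 1 by push_cast; omega]

theorem hasPath_segmentEnergy (W : ℝ → ℝ) (y : ℤ → ℝ) {j k : ℤ} (hjk : j < k) :
    HasPath W (k - j).toNat (y j) (y k) (segmentEnergy (fkH W) y j k) := by
  refine ⟨fun t => y (j + t), by simp, ?_, ?_⟩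
  · simp only
    congr 1; omega
  · rw [segmentEnergy_eq_sum_range, segE, Nat.Ico_zero_eq_range]

theorem IsMinSeg.segmentEnergy_le {W : ℝ → ℝ} {n : ℕ} {x : ℕ → ℝ} (hx : IsMinSeg W n x) {m : ℕ}
    {z y : ℤ → ℝ} (hz : ∀ i, z i = x (m + i).toNat) {j k : ℤ} (hjk : j < k) (hj : 0 ≤ m + j)
    (hk : m + k ≤ n) (hyj : y j = z j) (hyk : y k = z k) :
    segmentEnergy (fkH W) z j k ≤ segmentEnergy (fkH W) y j k := by
  have p := hasPath_segmentEnergy W y hjk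
  rw [hyj, hyk, hz, hz] at p
  have h := hx.replace (show (m + j).toNat ≤ (m + k).toNat by omega) (by omega)
    (p.cast (by omega) rfl rfl rfl)
  refine le_trans (le_of_eq ?_) h
  rw [segmentEnergy_eq_sum_range, segE, Finset.sum_Ico_eq_sum_range,
    show (m + k).toNat - (m + j).toNat = (k - j).toNat by omega]
  refine Finset.sum_congr rfl fun t _ => ?_
  rw [hz, hz]
  congr 2 <;> omega

theorem hasRotationNumber_of_forall_le {x : ℤ → ℝ} {r : ℝ}
    (h : ∀ ε > 0, ∃ C : ℝ, ∀ i : ℤ, |x i - r * i| ≤ ε * |(i : ℝ)| + C) :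
    HasRotationNumber x r := by
  have key : ∀ l : Filter ℤ, Tendsto (fun i : ℤ => |(i : ℝ)|) l atTop →
      Tendsto (fun i : ℤ => x i / (i : ℝ)) l (𝓝 r) := by
    intro l hl
    rw [Metric.tendsto_nhds]
    intro ε hε
    obtain ⟨C, hC⟩ := h (ε / 2) (by positivity)
    filter_upwards [hl.eventually_gt_atTop (max 0 (C / (ε / 2)))] with i hi
    have hi0 : 0 < |(i : ℝ)| := (le_max_left _ _).trans_lt hi
    have hi1 : C / (ε / 2) < |(i : ℝ)| := (le_max_right _ _).trans_lt hi
    rw [div_lt_iff₀ (by positivity)] at hi1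
    have hne : (i : ℝ) ≠ 0 := abs_pos.1 hi0
    rw [Real.dist_eq, show x i / i - r = (x i - r * i) / i by field_simp, abs_div,
      div_lt_iff₀ hi0]
    have := hC i
    linarith
  exact ⟨key _ (tendsto_abs_atTop_atTop.comp tendsto_intCast_atTop_atTop),
    key _ (tendsto_abs_atBot_atTop.comp (tendsto_intCast_atBot_iff.2 tendsto_id))⟩

/-- Centred segments of least energy, of increasing length. -/
theorem exists_centred_segments : ∃ z : ℕ → ℤ → ℝ,
    (∀ j k : ℤ, j < k → ∀ᶠ N in atTop, ∀ y : ℤ → ℝ, y j = z N j → y k = z N k →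
      segmentEnergy (fkH V) (z N) j k ≤ segmentEnergy (fkH V) y j k) ∧
    (∀ i : ℤ, ∀ᶠ N in atTop, |z N i| ≤ 8 * |(i : ℝ)| + 8) ∧
    ∀ ε > 0, ∃ C : ℝ, ∀ i : ℤ, ∀ᶠ N in atTop, |z N i - rot * i| ≤ ε * |(i : ℝ)| + C := by
  have hex : ∀ N : ℕ, ∃ x : ℕ → ℝ, 10 ≤ N → IsRotSeg (2 * N) x ∧ x 0 ≤ -rot * N + 1 / 3 ∧
      rot * N - 1 / 3 ≤ x (2 * N) := by
    intro N
    by_cases hN : 10 ≤ N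
    · obtain ⟨x, hx, h1, h2⟩ := exists_isRotSeg (n := 2 * N) (by omega) (-rot * N)
      rw [abs_le] at h1 h2
      push_cast at h2
      exact ⟨x, fun _ => ⟨hx, by linarith [h1.2], by linarith [h2.1]⟩⟩
    · exact ⟨0, fun h => absurd h hN⟩
  choose x hx using hex
  set m : ℕ → ℕ := fun N => rk (x N) 0
  have hθ := rot_gt
  -- Steps of length at most 8 need at least `N / 4` indices on either side of the origin, so the
  -- segments exhaust `ℤ`; the truncation in `toNat` below is eventually harmless.
  have hm : ∀ N, 10 ≤ N → N ≤ 4 * m N ∧ N ≤ 4 * (2 * N - m N) ∧ m N ≤ 2 * N ∧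
      0 ≤ x N (m N) ∧ x N (m N) ≤ 8 := by
    intro N hN
    obtain ⟨h1, h2, h3⟩ := hx N hN
    have hN' : (10 : ℝ) ≤ N := by exact_mod_cast hN
    have h4 : x N 0 < 0 := by nlinarith
    have h5 : 0 ≤ x N (2 * N) := by nlinarith
    have h6 : m N ≤ 2 * N := rk_le h5
    have h7 : 0 ≤ x N (m N) := le_rk h5
    have h8 : x N (m N) ≤ 0 + 8 := h1.rk_le_add h4 h5
    have h9 := h1.le_add_steps (Nat.zero_le (m N)) h6
    have h10 := h1.le_add_steps h6 le_rfl
    push_cast at h9 h10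
    refine ⟨?_, ?_, h6, h7, by linarith⟩
    · have : (N : ℝ) ≤ 4 * m N := by nlinarith
      exact_mod_cast this
    · have h11 : (N : ℝ) ≤ 4 * ((2 * N : ℝ) - m N) := by nlinarith
      have : (N : ℝ) ≤ ((4 * (2 * N - m N) : ℕ) : ℝ) := by
        push_cast [Nat.cast_sub h6]; exact h11
      exact_mod_cast this
  refine ⟨fun N i => x N ((m N : ℤ) + i).toNat, ?_, ?_, ?_⟩
  · intro j k hjk
    filter_upwards [eventually_ge_atTop (10 + 4 * j.natAbs + 4 * k.natAbs)] with N hN y hyj hyk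
    obtain ⟨h1, -⟩ := hx N (by omega)
    obtain ⟨h2, h3, h4, -⟩ := hm N (by omega)
    exact h1.isMin.segmentEnergy_le (fun _ => rfl) hjk (by omega) (by push_cast; omega) hyj hyk
  · intro i
    filter_upwards [eventually_ge_atTop (10 + 4 * i.natAbs)] with N hN
    obtain ⟨h1, -⟩ := hx N (by omega)
    obtain ⟨h2, h3, h4, h5, h6⟩ := hm N (by omega)
    rcases le_total 0 i with hi | hi
    · have h7 := h1.mono (show m N ≤ (m N + i).toNat by omega) (by omega)
      have h8 := h1.le_add_steps (show m N ≤ (m N + i).toNat by omega) (by omega)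
      have e : (((m N + i).toNat : ℕ) : ℝ) = m N + i := by
        exact_mod_cast Int.toNat_of_nonneg (show 0 ≤ (m N : ℤ) + i by omega)
      rw [e] at h8
      rw [abs_of_nonneg (show (0 : ℝ) ≤ i by exact_mod_cast hi), abs_le]
      constructor <;> linarith
    · have h7 := h1.mono (show (m N + i).toNat ≤ m N by omega) (by omega)
      have h8 := h1.le_add_steps (show (m N + i).toNat ≤ m N by omega) (by omega)
      have e : (((m N + i).toNat : ℕ) : ℝ) = m N + i := by
        exact_mod_cast Int.toNat_of_nonneg (show 0 ≤ (m N : ℤ) + i by omega)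
      rw [e] at h8
      have hi' : (i : ℝ) ≤ 0 := by exact_mod_cast hi
      rw [abs_of_nonpos hi', abs_le]
      constructor <;> linarith
  · intro ε hε
    obtain ⟨C, n₀, hC⟩ := exists_uniform_bound hε
    refine ⟨C + 8, fun i => ?_⟩
    obtain ⟨N₁, hN₁⟩ := exists_nat_gt (|C| + 8 * |(i : ℝ)| + 20)
    filter_upwards [eventually_ge_atTop (10 + 4 * i.natAbs + n₀ + N₁)] with N hN
    obtain ⟨h1, h1a, h1b⟩ := hx N (by omega)
    obtain ⟨h2, h3, h4, h5, h6⟩ := hm N (by omega)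
    have hNN : (N₁ : ℝ) ≤ N := by exact_mod_cast (show N₁ ≤ N by omega)
    have hrN : 2 * (N : ℝ) ≤ rot * N := by nlinarith
    have hCa := le_abs_self C
    have hia := abs_nonneg (i : ℝ)
    have hCb := abs_nonneg C
    have e : (((m N + i).toNat : ℕ) : ℝ) = m N + i := by
      exact_mod_cast Int.toNat_of_nonneg (show 0 ≤ (m N : ℤ) + i by omega)
    rcases le_total 0 i with hi | hi
    · have hi' : (0 : ℝ) ≤ i := by exact_mod_cast hi
      rw [abs_of_nonneg hi'] at hN₁ hia ⊢
      have h8 := h1.le_add_steps (show m N ≤ (m N + i).toNat by omega) (by omega)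
      rw [e] at h8
      have h9 := hC (2 * N) (x N) (by omega) h1 (m N) (m N + i).toNat (by omega) (by omega)
        (by linarith) (by linarith)
      rw [e, abs_le] at h9
      rw [abs_le]
      constructor <;> linarith [h9.1, h9.2]
    · have hi' : (i : ℝ) ≤ 0 := by exact_mod_cast hi
      rw [abs_of_nonpos hi'] at hN₁ hia ⊢
      have h8 := h1.le_add_steps (show (m N + i).toNat ≤ m N by omega) (by omega)
      rw [e] at h8
      have h9 := hC (2 * N) (x N) (by omega) h1 (m N + i).toNat (m N) (by omega) (by omega)
        (by linarith) (by linarith)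
      rw [e, abs_le] at h9
      rw [abs_le]
      constructor <;> linarith [h9.1, h9.2]

theorem exists_minimal_config : ∃ x : ℤ → ℝ, IsMinimalConfig (fkH V) x ∧
    HasRotationNumber x rot := by
  obtain ⟨z, hmin, hbd, hrot⟩ := exists_centred_segments
  -- Limits along an ultrafilter replace a diagonal subsequence.
  have hU : (hyperfilter ℕ : Filter ℕ) ≤ atTop := Nat.hyperfilter_le_atTop
  have hlim : ∀ i : ℤ, ∃ a : ℝ, Tendsto (fun N => z N i) (hyperfilter ℕ) (𝓝 a) := by
    intro i
    obtain ⟨a, -, ha⟩ := (isCompact_Icc (a := -(8 * |(i : ℝ)| + 8))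
      (b := 8 * |(i : ℝ)| + 8)).ultrafilter_le_nhds' ((hyperfilter ℕ).map fun N => z N i) (by
        rw [Ultrafilter.mem_map]
        filter_upwards [hU (hbd i)] with N hN using abs_le.1 hN)
    exact ⟨a, ha⟩
  choose x hx using hlim
  have hE : ∀ (j k : ℤ) (u : ℕ → ℤ → ℝ) (y : ℤ → ℝ),
      (∀ i, Tendsto (fun N => u N i) (hyperfilter ℕ) (𝓝 (y i))) →
      Tendsto (fun N => segmentEnergy (fkH V) (u N) j k) (hyperfilter ℕ)
        (𝓝 (segmentEnergy (fkH V) y j k)) := by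
    intro j k u y hu
    refine tendsto_finsetSum _ fun i _ => ?_
    exact ((((hu i).sub (hu (i + 1))).pow 2).const_mul _).add
      ((V_continuous.tendsto _).comp (hu i))
  refine ⟨x, fun j k hjk y hyj hyk => ?_, hasRotationNumber_of_forall_le fun ε hε => ?_⟩
  -- The competitor must share the end points of the `N`-th segment; this correction tends to 0.
  · set u : ℕ → ℤ → ℝ := fun N i => if i = j then z N j else if i = k then z N k else y i with hu
    have h1 := hE j k z x hx
    have h2 : Tendsto (fun N => segmentEnergy (fkH V) (u N) j k) (hyperfilter ℕ)
        (𝓝 (segmentEnergy (fkH V) y j k)) := by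
      refine hE j k u y fun i => ?_
      simp only [hu]
      split_ifs with h3 h4
      · rw [h3, hyj]; exact hx j
      · rw [h4, hyk]; exact hx k
      · exact tendsto_const_nhds
    refine le_of_tendsto_of_tendsto h1 h2 ?_
    filter_upwards [hU (hmin j k hjk)] with N hN
    exact hN (u N) (by simp [hu]) (by simp [hu, hjk.ne'])
  · obtain ⟨C, hC⟩ := hrot ε hε
    refine ⟨C, fun i => ?_⟩
    have h1 : Tendsto (fun N => |z N i - rot * i|) (hyperfilter ℕ) (𝓝 |x i - rot * i|) :=
      ((hx i).sub_const _).abs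
    exact le_of_tendsto h1 (hU (hC i))

/-! ### An equilibrium on top of the potential -/

/-- The linearised equilibrium equations have a bounded solution. -/
theorem exists_bounded_solution {d : ℤ → ℝ} {D : ℝ} (hd : ∀ i, |d i| ≤ D) :
    ∃ y : ℤ → ℝ, (∀ i, 126 * y i + y (i - 1) + y (i + 1) = d i) ∧ ∀ i, |y i| ≤ D / 124 := by
  have hD : 0 ≤ D := (abs_nonneg _).trans (hd 0)
  let Φ : (BoundedContinuousFunction ℤ ℝ) → (BoundedContinuousFunction ℤ ℝ) := fun y =>
    BoundedContinuousFunction.ofNormedAddCommGroup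
      (fun i => (d i - y (i - 1) - y (i + 1)) / 126) continuous_of_discreteTopology
      ((D + 2 * ‖y‖) / 126) (by
        intro i
        have h1 := hd i
        have h2 := y.norm_coe_le_norm (i - 1)
        have h3 := y.norm_coe_le_norm (i + 1)
        rw [Real.norm_eq_abs, abs_le] at h2 h3
        rw [abs_le] at h1
        rw [Real.norm_eq_abs, abs_le]
        constructor <;> linarith [h1.1, h1.2, h2.1, h2.2, h3.1, h3.2])
  have hΦ : ∀ y i, Φ y i = (d i - y (i - 1) - y (i + 1)) / 126 := fun _ _ => rfl
  -- The off-diagonal coefficients sum to 2 against 126 on the diagonal; the constant `1/2` is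
  -- generous.
  have hc : ContractingWith (1 / 2) Φ := by
    refine ⟨by norm_num [← NNReal.coe_lt_coe], LipschitzWith.of_dist_le_mul fun y z => ?_⟩
    rw [BoundedContinuousFunction.dist_le (by positivity)]
    intro i
    have h2 := BoundedContinuousFunction.dist_coe_le_dist (f := y) (g := z) (i - 1)
    have h3 := BoundedContinuousFunction.dist_coe_le_dist (f := y) (g := z) (i + 1)
    rw [Real.dist_eq, abs_le] at h2 h3
    rw [hΦ, hΦ, Real.dist_eq, abs_le]
    have h4 : (0 : ℝ) ≤ dist y z := dist_nonneg
    push_cast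
    constructor <;> linarith [h2.1, h2.2, h3.1, h3.2]
  set y := ContractingWith.fixedPoint Φ hc
  have hy : Φ y = y := hc.fixedPoint_isFixedPt
  have hy' : ∀ i, (d i - y (i - 1) - y (i + 1)) / 126 = y i := fun i => by
    rw [← hΦ, hy]
  have hn : ‖y‖ ≤ (D + 2 * ‖y‖) / 126 := by
    rw [BoundedContinuousFunction.norm_le (by positivity)]
    intro i
    rw [← hy' i]
    have h1 := hd i
    have h2 := y.norm_coe_le_norm (i - 1)
    have h3 := y.norm_coe_le_norm (i + 1)
    rw [Real.norm_eq_abs, abs_le] at h2 h3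
    rw [abs_le] at h1
    rw [Real.norm_eq_abs, abs_le]
    constructor <;> linarith [h1.1, h1.2, h2.1, h2.2, h3.1, h3.2]
  refine ⟨y, fun i => by linarith [hy' i], fun i => ?_⟩
  have := y.norm_coe_le_norm i
  rw [Real.norm_eq_abs] at this
  linarith

theorem V_eq_of_near {x : ℝ} {k : ℤ} (h : |x - chain k| ≤ 1 / 4) :
    V x = -64 * (x - chain k) ^ 2 + 160 / 27 := by
  rw [V_eq_zeta (lt_of_le_of_lt h (by norm_num)), zeta, if_pos h]

theorem hasDerivAt_V_of_near {x : ℝ} {k : ℤ} (h : |x - chain k| < 1 / 4) :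
    HasDerivAt V (-128 * (x - chain k)) x := by
  have h1 : HasDerivAt (fun u => -64 * (u - chain k) ^ 2 + 160 / 27) (-128 * (x - chain k)) x := by
    refine (((((hasDerivAt_id x).sub_const (chain k)).pow 2).const_mul (-64)).add_const
      (160 / 27)).congr_deriv ?_
    simp
    ring
  refine h1.congr_of_eventuallyEq ?_
  have h2 : ∀ᶠ u in 𝓝 x, |u - chain k| < 1 / 4 :=
    (by fun_prop : Continuous fun u : ℝ => |u - chain k|).continuousAt.eventually_lt_const h
  filter_upwards [h2] with u hu using V_eq_of_near hu.le

/-- A point on top of a bump can be moved with a gain of energy. -/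
theorem not_isMinimalConfig_of_near {x : ℤ → ℝ} {k : ℤ} (h : |x 0 - chain k| < 1 / 4)
    (he : 2 * x 0 - x (-1) - x 1 - 128 * (x 0 - chain k) = 0) :
    ¬ IsMinimalConfig (fkH V) x := by
  intro hmin
  set t := 1 / 4 - |x 0 - chain k| with ht
  have ht0 : 0 < t := by linarith
  have h1 := hmin (-1) 1 (by norm_num) (fun i => if i = 0 then x 0 + t else x i)
    (by norm_num) (by norm_num)
  have h2 : |x 0 + t - chain k| ≤ 1 / 4 := by
    rw [show x 0 + t - chain k = (x 0 - chain k) + t by ring]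
    refine (abs_add_le _ _).trans ?_
    rw [abs_of_pos ht0]; linarith
  have e : ∀ y : ℤ → ℝ, segmentEnergy (fkH V) y (-1) 1
      = fkH V (y (-1)) (y 0) + fkH V (y 0) (y 1) := by
    intro y
    rw [segmentEnergy_eq_sum_range, show ((1 : ℤ) - -1).toNat = 2 from rfl]
    norm_num [Finset.sum_range_succ]
  rw [e, e] at h1
  norm_num [fkH, V_eq_of_near h2, V_eq_of_near h.le] at h1
  -- The linear terms cancel by `he`, and the displacement changes the energy by `t ^ 2 - 64 * t ^ 2
  -- < 0`.
  nlinarith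

theorem exists_equilibrium : ∃ x : ℤ → ℝ, IsEquilibrium (fkH V) x ∧
    ¬ IsMinimalConfig (fkH V) x ∧ HasRotationNumber x rot ∧
    ∀ i : ℤ, |x i - nearest (rot * i)| ≤ Real.goldenRatio / 62 := by
  have hτ := goldenRatio_lt
  set c : ℤ → ℝ := fun i => nearest (rot * i) with hc
  have hcr : ∀ i : ℤ, |rot * i - c i| ≤ Real.goldenRatio / 2 := fun i => abs_sub_nearest_le _
  -- Second differences annihilate `rot * i`, leaving four deviations of at most `τ / 2` each. The
  -- coefficient 126 is `128 - 2`, from `V'` and the elastic term; the resulting bound `τ / 62` is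
  -- below `1/4`, within the quadratic part of the bump.
  obtain ⟨y, hy, hyb⟩ := exists_bounded_solution (d := fun i => 2 * c i - c (i - 1) - c (i + 1))
    (D := 2 * Real.goldenRatio) (by
      intro i
      have h1 := hcr i
      have h2 := hcr (i - 1)
      have h3 := hcr (i + 1)
      push_cast at h2 h3
      rw [abs_le] at h1 h2 h3 ⊢
      constructor <;> linarith [h1.1, h1.2, h2.1, h2.2, h3.1, h3.2])
  have hyb' : ∀ i, |y i| ≤ Real.goldenRatio / 62 := fun i => (hyb i).trans (by linarith)
  have hnear : ∀ i, |y i| < 1 / 4 := fun i => (hyb' i).trans_lt (by linarith)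
  choose k hk using fun i : ℤ => exists_nearest_eq (rot * i)
  have hk' : ∀ i, c i = chain (k i) := hk
  refine ⟨fun i => c i + y i, fun i => ?_, ?_, ?_, fun i => by simpa [hc] using hyb' i⟩
  · have hV := hasDerivAt_V_of_near (x := c i + y i) (k := k i) (by
      rw [← hk', add_sub_cancel_left]; exact hnear i)
    rw [← hk', add_sub_cancel_left] at hV
    refine ⟨-((c (i - 1) + y (i - 1)) - (c i + y i)),
      ((c i + y i) - (c (i + 1) + y (i + 1))) + -128 * y i, ?_, ?_, ?_⟩
    · refine (((((hasDerivAt_id (c i + y i)).const_sub (c (i - 1) + y (i - 1))).pow 2).const_mul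
        (1 / 2)).add_const (V (c (i - 1) + y (i - 1)))).congr_deriv ?_
      simp
    · refine (((((hasDerivAt_id (c i + y i)).sub_const (c (i + 1) + y (i + 1))).pow 2).const_mul
        (1 / 2)).add hV).congr_deriv ?_
      simp
    · linarith [hy i]
  · refine not_isMinimalConfig_of_near (k := k 0) ?_ ?_
    · rw [← hk', add_sub_cancel_left]; exact hnear 0
    · rw [← hk', add_sub_cancel_left]
      have := hy 0
      norm_num at this ⊢
      linarith
  · refine hasRotationNumber_of_forall_le fun ε hε => ⟨2, fun i => ?_⟩
    have h1 := hcr i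
    have h2 := hyb' i
    have h3 : 0 ≤ ε * |(i : ℝ)| := by positivity
    rw [abs_le] at h1 h2 ⊢
    constructor <;> linarith [h1.1, h1.2, h2.1, h2.2]

end FibFK

theorem theorem1 :
    (∃ x : ℤ → ℝ, FibFK.IsMinimalConfig (FibFK.fkH FibFK.V) x ∧
      FibFK.HasRotationNumber x ((3 * Real.goldenRatio + 1) / 2)) ∧
    (∃ x : ℤ → ℝ, FibFK.IsEquilibrium (FibFK.fkH FibFK.V) x ∧
      ¬ FibFK.IsMinimalConfig (FibFK.fkH FibFK.V) x ∧
      FibFK.HasRotationNumber x ((3 * Real.goldenRatio + 1) / 2) ∧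
      ∀ i : ℤ, |x i - FibFK.nearest ((3 * Real.goldenRatio + 1) / 2 * i)| ≤
        Real.goldenRatio / 62) :=
  ⟨FibFK.exists_minimal_config, FibFK.exists_equilibrium⟩
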